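/- A seller can produce one indivisible object for a buyer. The buyer's private value $\theta\in[0,1]$ has distribution $F$ with an a.e. positive density $f$; the seller's cost $\omega\in[0,1]$ is independent of $\theta$ and has distribution $G$ with an a.e. positive density $g$. Assume $F$ is regular: $\psi(\theta,1)=\theta-\frac{1-F(\theta)}{f(\theta)}$ is strictly increasing in $\theta$ (on the set of $\theta\in[0,1]$ with $f(\theta)>0$). The seller learns $\omega$ only at time 1; both parties are risk-neutral with common discount factor $\delta\in(0,1)$; delivery takes place one period after agreement, and payoffs agreed at time 1 are discounted by $\delta$. The seller's maximal ex-ante expected profits from four classes of mechanisms are defined as follows. - EAFP (ex-ante fixed price): at time 0 the seller posts a price $p\in\mathbb R$ with guaranteed delivery, and the types $\theta\ge p$ buy: $\pi^{EAFP}=\max_{p}\,(1-F(p))(p-\mathbb E_G[\omega])$. - EPO (ex-post optimal): $\pi^{EPO}(\delta)=\delta\max_{q,t}\int_0^1\!\int_0^1 (t(\theta,\omega)-\omega q(\theta,\omega))\,dG(\omega)\,dF(\theta)$ over measurable $(q,t)$ with $q(\theta,\omega)\in[0,1]$, $t(\theta,\omega)\in\mathbb R$ and integrable $t-\omega q$,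 such that for all $\theta,\theta',\omega\in[0,1]$ the buyer's constraints $\theta q(\theta,\omega)-t(\theta,\omega)\ge 0$ and $\theta q(\theta,\omega)-t(\theta,\omega)\ge\theta q(\theta',\omega)-t(\theta',\omega)$ hold. - EAO (ex-ante optimal): $\pi^{EAO}=\max_{q,t}\int_0^1\!\int_0^1 (t-\omega q)\,dG\,dF$ under the same constraints and, in addition, the seller's truth-telling constraint $t(\theta,\omega)-\omega q(\theta,\omega)\ge t(\theta,\omega')-\omega q(\theta,\omega')$ for all $\theta,\omega,\omega'\in[0,1]$. - D (dynamic): at time 0 the seller posts a price $p_0$ with guaranteed delivery. If the buyer rejects it, the seller learns $\omega$ and offers a price $p_1(\omega)$, to which she has not committed, and which a buyer of type $\theta$ accepts iff $\theta\ge p_1(\omega)$. Consider perfect Bayesian equilibria with a threshold $x\in[0,1]$: types above $x$ accept $p_0$ and types below $x$ reject it; after a rejection the seller's belief $\beta$ about $\theta$ is a probability measure on $[0,1]$, equal to $F$ conditioned on $\theta<x$ whenever $F(x)>0$; for every $\omega\in[0,1]$, $p_1(\omega)$ maximizes $(p-\omega)\,\beta([p,\infty))$ over $p\in\mathbb R$;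 and $\theta-p_0\ge\delta\,\mathbb E_G[\max(\theta-p_1(\omega),0)]$ for all types $\theta>x$, with the reverse inequality for all types $\theta<x$. The resulting profit is $(1-F(x))(p_0-\mathbb E_G[\omega])+\delta\int_0^1 (p_1(\omega)-\omega)\,\Pr_F[\,p_1(\omega)\le\theta<x\,]\,dG(\omega)$, and $\pi^{D}(\delta)$ is its maximum over $p_0$ and all such equilibria. Theorem. All these maxima are attained. There is $\overline\delta\in(0,1)$ such that $\pi^{EPO}(\delta)>\pi^{EAO}$ for all $\delta\in(\overline\delta,1)$ and $\pi^{EPO}(\delta)<\pi^{EAO}$ for all $\delta\in(0,\overline\delta)$. Moreover there is $\delta^{**}\in(0,1)$ with $\delta^{**}<\overline\delta$ such that $\pi^{D}(\delta^{**})=\pi^{EAO}$ and 1. for all $\delta\in(\delta^{**},1)$, $\pi^{D}(\delta)$ is strictly larger than each of $\pi^{EAFP}$, $\pi^{EPO}(\delta)$ and $\pi^{EAO}$; 2. for all $\delta\in(0,\delta^{**})$, $\pi^{EAO}$ is strictly larger than each of $\pi^{EAFP}$, $\pi^{EPO}(\delta)$ and $\pi^{D}(\delta)$. -/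

import Mathlib

open MeasureTheory ProbabilityTheory Set

noncomputable section

namespace DelayedTrade

/-- The probability law on `[0,1]` with Lebesgue density `f`. -/
def law (f : ℝ → ℝ) : Measure ℝ :=
  (volume.restrict (Icc (0 : ℝ) 1)).withDensity fun x => ENNReal.ofReal (f x)

/-- `f` is an almost everywhere positive probability density on `[0,1]`. -/
structure IsPositiveDensity (f : ℝ → ℝ) : Prop where
  measurable : Measurable f
  pos : ∀ᵐ x ∂(volume.restrict (Icc (0 : ℝ) 1)), 0 < f x
  total : ∫ x in Icc (0 : ℝ) 1, f x = 1

/-- The cumulative distribution function of the law with density `f`. -/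
def distFun (f : ℝ → ℝ) (x : ℝ) : ℝ := (law f).real (Iic x)

/-- The virtual valuation `ψ(θ, b) = θ - (F(b) - F(θ)) / f(θ)` of `F` truncated to `[0, b]`. -/
def virtualValue (f : ℝ → ℝ) (θ b : ℝ) : ℝ :=
  θ - (distFun f b - distFun f θ) / f θ

/-- Regularity of `F`: `ψ(·, 1)` is strictly increasing on the points of `[0,1]` at which it is
defined, i.e. those where the density is positive (almost all points of `[0,1]`). -/
def IsRegular (f : ℝ → ℝ) : Prop :=
  StrictMonoOn (fun θ => virtualValue f θ 1) {θ | θ ∈ Icc (0 : ℝ) 1 ∧ 0 < f θ}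

/-- The expected cost. -/
def meanCost (g : ℝ → ℝ) : ℝ := ∫ ω, ω ∂(law g)

/-! ### Ex-ante fixed price -/

/-- Profit of the price `p` posted at time 0 with guaranteed delivery: the types `θ ≥ p` buy and
are served whatever the cost. -/
def profitEAFP (f g : ℝ → ℝ) (p : ℝ) : ℝ := (law f).real (Ici p) * (p - meanCost g)

/-- The profits that ex-ante fixed price mechanisms achieve. -/
def achievableEAFP (f g : ℝ → ℝ) : Set ℝ := range (profitEAFP f g)

/-! ### Direct mechanisms -/

/-- The buyer's constraints on a direct mechanism: `q θ ω` is the probability of delivery and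
`t θ ω` the transfer from the buyer to the seller when the value is `θ` and the cost is `ω`. -/
structure BuyerFeasible (q t : ℝ → ℝ → ℝ) : Prop where
  measurable_q : Measurable (Function.uncurry q)
  measurable_t : Measurable (Function.uncurry t)
  q_mem : ∀ θ ∈ Icc (0 : ℝ) 1, ∀ ω ∈ Icc (0 : ℝ) 1, q θ ω ∈ Icc (0 : ℝ) 1
  participation : ∀ θ ∈ Icc (0 : ℝ) 1, ∀ ω ∈ Icc (0 : ℝ) 1, 0 ≤ θ * q θ ω - t θ ω
  truthful : ∀ θ ∈ Icc (0 : ℝ) 1, ∀ θ' ∈ Icc (0 : ℝ) 1, ∀ ω ∈ Icc (0 : ℝ) 1,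
    θ * q θ' ω - t θ' ω ≤ θ * q θ ω - t θ ω

/-- The seller is willing to report her cost truthfully. -/
def SellerTruthful (q t : ℝ → ℝ → ℝ) : Prop :=
  ∀ θ ∈ Icc (0 : ℝ) 1, ∀ ω ∈ Icc (0 : ℝ) 1, ∀ ω' ∈ Icc (0 : ℝ) 1,
    t θ ω' - ω * q θ ω' ≤ t θ ω - ω * q θ ω

/-- The seller's payoff at the type profile `z = (θ, ω)`. -/
def sellerPayoff (q t : ℝ → ℝ → ℝ) (z : ℝ × ℝ) : ℝ := t z.1 z.2 - z.2 * q z.1 z.2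

/-- The undiscounted expected profit of a direct mechanism; value and cost are independent. -/
def directProfit (f g : ℝ → ℝ) (q t : ℝ → ℝ → ℝ) : ℝ :=
  ∫ z, sellerPayoff q t z ∂((law f).prod (law g))

/-- The profits that ex-post mechanisms achieve: the seller offers the mechanism at time 1, when she
knows her cost, so only the buyer's constraints apply, and payoffs are discounted. -/
def achievableEPO (f g : ℝ → ℝ) (δ : ℝ) : Set ℝ :=
  {r | ∃ q t : ℝ → ℝ → ℝ, BuyerFeasible q t ∧
    Integrable (sellerPayoff q t) ((law f).prod (law g)) ∧ r = δ * directProfit f g q t}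

/-- The profits that ex-ante mechanisms achieve: the seller commits at time 0 to a mechanism under
which both sides report truthfully. -/
def achievableEAO (f g : ℝ → ℝ) : Set ℝ :=
  {r | ∃ q t : ℝ → ℝ → ℝ, BuyerFeasible q t ∧ SellerTruthful q t ∧
    Integrable (sellerPayoff q t) ((law f).prod (law g)) ∧ r = directProfit f g q t}

/-! ### The dynamic mechanism -/

/-- Perfect Bayesian equilibrium with threshold `x` after the time 0 price `p₀`: the types above `x`
accept `p₀` and get the good at time 1, the types below `x` reject it; after a rejection the seller
has the belief `β` about the buyer's type, learns her cost `ω` and offers the price `p₁ ω`, which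
the remaining types `θ ≥ p₁ ω` accept. -/
structure IsThresholdPBE (f g : ℝ → ℝ) (δ p₀ x : ℝ) (p₁ : ℝ → ℝ) (β : Measure ℝ) : Prop where
  threshold_mem : x ∈ Icc (0 : ℝ) 1
  measurable_price : Measurable p₁
  /-- The belief is a probability measure on `[0,1]`. -/
  belief_prob : IsProbabilityMeasure β
  belief_support : β (Icc (0 : ℝ) 1)ᶜ = 0
  /-- Bayes' rule, whenever a rejection has positive probability. -/
  belief_bayes : law f (Iio x) ≠ 0 → β = (law f)[|Iio x]
  /-- The seller does not commit to `p₁`: it is optimal for her given her belief and her cost. -/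
  price_optimal : ∀ ω ∈ Icc (0 : ℝ) 1, ∀ p : ℝ,
    (p - ω) * β.real (Ici p) ≤ (p₁ ω - ω) * β.real (Ici (p₁ ω))
  /-- Types above the threshold prefer the time 0 price to waiting. -/
  accept_optimal : ∀ θ ∈ Icc (0 : ℝ) 1, x < θ →
    δ * ∫ ω, max (θ - p₁ ω) 0 ∂(law g) ≤ θ - p₀
  /-- Types below the threshold prefer waiting to the time 0 price. -/
  reject_optimal : ∀ θ ∈ Icc (0 : ℝ) 1, θ < x →
    θ - p₀ ≤ δ * ∫ ω, max (θ - p₁ ω) 0 ∂(law g)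

/-- Profit of the dynamic mechanism: types `θ ≥ x` pay `p₀` at time 0 and are served whatever the
cost; at cost `ω` the types `p₁ ω ≤ θ < x` buy at the price `p₁ ω` one period later. -/
def profitD (f g : ℝ → ℝ) (δ p₀ x : ℝ) (p₁ : ℝ → ℝ) : ℝ :=
  (law f).real (Ici x) * (p₀ - meanCost g)
    + δ * ∫ ω, (p₁ ω - ω) * (law f).real (Ico (p₁ ω) x) ∂(law g)

/-- The profits that dynamic mechanisms achieve. -/
def achievableD (f g : ℝ → ℝ) (δ : ℝ) : Set ℝ :=
  {r | ∃ (p₀ x : ℝ) (p₁ : ℝ → ℝ) (β : Measure ℝ),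
    IsThresholdPBE f g δ p₀ x p₁ β ∧ r = profitD f g δ p₀ x p₁}

/-! ### Maximal profits -/

def maxEAFP (f g : ℝ → ℝ) : ℝ := sSup (achievableEAFP f g)

def maxEAO (f g : ℝ → ℝ) : ℝ := sSup (achievableEAO f g)

def maxEPO (f g : ℝ → ℝ) (δ : ℝ) : ℝ := sSup (achievableEPO f g δ)

def maxD (f g : ℝ → ℝ) (δ : ℝ) : ℝ := sSup (achievableD f g δ)

end DelayedTrade

end

/-!
Write `S p` for the demand `F [p, ∞)`, `c` for the mean cost, and `h p ω = S p (p - ω)` for the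
revenue net of cost. Only a few features of the two laws matter: they live on `[0,1]`, have no
atoms and charge every subinterval (`FullLaw`). Each of the four problems reduces to prices.

*Ex-post optimum.* At a fixed cost the allocation is monotone in the value and the envelope
formula (`integral_subgradient`) determines the transfers. A monotone allocation is a mixture of
thresholds, so the best price is optimal (`integral_le_of_threshold_bound`), and the maximum is `δ
L` with `L = E maxₚ h p ω` (`lateRevenue` at `1`).

*Ex-ante optimum.* If both sides are truthful ex post, comparing the two envelope formulas gives a
Volterra equation whose only solution is zero (`volterra_eq_zero`): above the diagonal the
allocation is a function of the value plus a function of the cost (`allocation_cross_difference`).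
With this, the seller's payoff at `(θ, ω)` is bounded through the allocation at cost `0` alone
(`sellerPayoff_le_of_lt`). Averaging over `ω` leaves a screening problem in which serving the
types above `p` is worth `E (p - ω)⁺` per type, so the maximum is `M = maxₚ S p E (p - ω)⁺`: a
posted price at which either side may refuse.

*Dynamic mechanism.* A threshold `x > 0` determines the late prices at almost every cost, since
the optimal price is a monotone correspondence of the cost (`ae_optimalPrice_unique`), and the
time 0 price by indifference. The profit is then `(1 - δ) h x c + δ C x`, where `C x` is the
revenue over all types of the late prices (`IsThresholdPBE.profit_eq`), and it is continuous in
`x`. Its maximum `D δ` is convex in `δ`, being a maximum of affine functions, and `D 0` is the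
best ex-ante fixed price.

*Comparison.* The option to refuse gives `D 0 < M`, and adapting prices to the cost gives `M < L`,
so the ex-post and ex-ante optima cross at `δ = M / L`. Lowering the threshold slightly below `1`
gains to first order and loses only to higher order, hence `δ L < D δ` for every `δ < 1`
(`late_lt_bestDynamic`); in particular `D (M / L) > M`. By convexity `D` crosses the level `M`
exactly once, from below, at some point before `M / L`.
-/

namespace DelayedTrade

open Filter Topology

/-! ### Laws on the unit interval -/

/-- A probability measure carried by `[0,1]`, without atoms, that charges every nondegenerate
subinterval of `[0,1]`.  This is all that the argument uses about the two laws. -/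
class FullLaw (μ : Measure ℝ) : Prop extends IsProbabilityMeasure μ, NullSingletonClass μ where
  ae_mem : ∀ᵐ x ∂μ, x ∈ Icc (0 : ℝ) 1
  pos : ∀ a b : ℝ, 0 ≤ a → a < b → b ≤ 1 → 0 < μ (Ioo a b)

theorem IsPositiveDensity.fullLaw {f : ℝ → ℝ} (hf : IsPositiveDensity f) : FullLaw (law f) := by
  have hac : law f ≪ volume.restrict (Icc (0 : ℝ) 1) := withDensity_absolutelyContinuous _ _
  have hac' : volume.restrict (Icc (0 : ℝ) 1) ≪ law f := by
    refine withDensity_absolutelyContinuous' hf.measurable.ennreal_ofReal.aemeasurable ?_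
    filter_upwards [hf.pos] with x hx
    simpa using hx
  have hint : Integrable f (volume.restrict (Icc (0 : ℝ) 1)) := by
    by_contra h
    have := hf.total
    rw [integral_undef h] at this
    exact zero_ne_one this
  have hprob : IsProbabilityMeasure (law f) := by
    refine ⟨?_⟩
    rw [law, withDensity_apply _ MeasurableSet.univ, Measure.restrict_univ,
      ← ofReal_integral_eq_lintegral_ofReal hint (hf.pos.mono fun x hx => hx.le), hf.total,
      ENNReal.ofReal_one]
  have hna : NullSingletonClass (law f) := ⟨fun x => hac (by simp)⟩
  refine { hprob, hna with ae_mem := ?_, pos := ?_ }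
  · exact hac.ae_le (ae_restrict_mem measurableSet_Icc)
  · intro a b ha hab hb
    rw [pos_iff_ne_zero]
    intro h
    have h0 := hac' h
    rw [Measure.restrict_apply measurableSet_Ioo,
      inter_eq_self_of_subset_left (Ioo_subset_Icc_self.trans (Icc_subset_Icc ha hb)),
      Real.volume_Ioo] at h0
    simp only [ENNReal.ofReal_eq_zero] at h0
    linarith

/-- The demand `μ [p, ∞)` at the price `p`. -/
noncomputable def demand (μ : Measure ℝ) (p : ℝ) : ℝ := μ.real (Ici p)

variable {μ ν : Measure ℝ}

theorem demand_nonneg (p : ℝ) : 0 ≤ demand μ p := measureReal_nonneg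

theorem demand_le_one [FullLaw μ] (p : ℝ) : demand μ p ≤ 1 := measureReal_le_one

theorem demand_antitone [FullLaw μ] : Antitone (demand μ) := fun _ _ h =>
  measureReal_mono (Ici_subset_Ici.2 h)

theorem demand_of_nonpos [FullLaw μ] {p : ℝ} (hp : p ≤ 0) : demand μ p = 1 := by
  have h : Ici p =ᵐ[μ] (univ : Set ℝ) := by
    rw [eventuallyEq_univ]
    filter_upwards [FullLaw.ae_mem (μ := μ)] with x hx using hp.trans hx.1
  rw [demand, measureReal_congr h, probReal_univ]

theorem demand_of_one_le [FullLaw μ] {p : ℝ} (hp : 1 ≤ p) : demand μ p = 0 := by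
  have h : Ici p =ᵐ[μ] (∅ : Set ℝ) := by
    rw [ae_eq_empty, measure_eq_zero_iff_ae_notMem]
    have h1 : ∀ᵐ x ∂μ, x ≠ 1 := by simp [ae_iff]
    filter_upwards [FullLaw.ae_mem (μ := μ), h1] with x hx hx1 hpx
    exact hx1 (le_antisymm hx.2 (hp.trans hpx))
  rw [demand, measureReal_congr h, measureReal_empty]

/-- The interval `[a, b)` has probability `demand a - demand b`. -/
theorem measureReal_Ico_eq [FullLaw μ] {a b : ℝ} (hab : a ≤ b) :
    μ.real (Ico a b) = demand μ a - demand μ b := by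
  rw [demand, demand, ← measureReal_sdiff (Ici_subset_Ici.2 hab) measurableSet_Ici, Ici_sdiff_Ici]

theorem demand_strictAnti [FullLaw μ] {a b : ℝ} (ha : 0 ≤ a) (hab : a < b) (hb : b ≤ 1) :
    demand μ b < demand μ a := by
  have h : 0 < μ.real (Ico a b) :=
    ENNReal.toReal_pos ((FullLaw.pos a b ha hab hb).trans_le
      (measure_mono Ioo_subset_Ico_self)).ne' (measure_ne_top _ _)
  rw [measureReal_Ico_eq hab.le] at h
  linarith

theorem demand_pos [FullLaw μ] {p : ℝ} (hp : p < 1) : 0 < demand μ p := by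
  have h := demand_strictAnti (μ := μ) (le_max_left 0 p) (max_lt one_pos hp) le_rfl
  rw [demand_of_one_le le_rfl] at h
  exact h.trans_le (demand_antitone (le_max_right 0 p))

theorem demand_lt_one [FullLaw μ] {p : ℝ} (hp : 0 < p) : demand μ p < 1 := by
  have h := demand_strictAnti (μ := μ) le_rfl (lt_min hp one_pos) (min_le_right p 1)
  rw [demand_of_nonpos le_rfl] at h
  exact (demand_antitone (min_le_left p 1)).trans_lt h

theorem continuous_demand [FullLaw μ] : Continuous (demand μ) := by
  have h : demand μ = fun p => ∫ θ, (Ici p).indicator (fun _ => (1 : ℝ)) θ ∂μ := by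
    ext p
    rw [integral_indicator_const _ measurableSet_Ici, smul_eq_mul, mul_one, demand]
  rw [h, continuous_iff_continuousAt]
  intro p
  refine continuousAt_of_dominated (bound := fun _ => 1) ?_ ?_ (integrable_const _) ?_
  · exact Eventually.of_forall fun q =>
      (measurable_const.indicator measurableSet_Ici).aestronglyMeasurable
  · refine Eventually.of_forall fun q => Eventually.of_forall fun θ => ?_
    by_cases hθ : θ ∈ Ici q <;> simp [hθ]
  · have h1 : ∀ᵐ x ∂μ, x ≠ p := by simp [ae_iff]
    filter_upwards [h1] with θ hθ
    rcases lt_or_gt_of_ne hθ with h | h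
    · refine (continuousAt_const (y := (0 : ℝ))).congr ?_
      filter_upwards [lt_mem_nhds h] with q hq
      simp [hq]
    · refine (continuousAt_const (y := (1 : ℝ))).congr ?_
      filter_upwards [gt_mem_nhds h] with q hq
      simp [le_of_lt hq]

/-- A measurable function that is bounded on `[0,1]` is integrable. -/
theorem integrable_of_bdd [FullLaw μ] {φ : ℝ → ℝ} {C : ℝ} (hφ : AEStronglyMeasurable φ μ)
    (hC : ∀ x ∈ Icc (0 : ℝ) 1, |φ x| ≤ C) : Integrable φ μ :=
  Integrable.of_bound hφ C ((FullLaw.ae_mem (μ := μ)).mono fun x hx => hC x hx)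

theorem integrable_of_continuous [FullLaw μ] {φ : ℝ → ℝ} (hφ : Continuous φ) :
    Integrable φ μ := by
  obtain ⟨C, hC⟩ := (isCompact_Icc (a := (0 : ℝ)) (b := 1)).exists_bound_of_continuousOn
    hφ.continuousOn
  exact integrable_of_bdd hφ.aestronglyMeasurable hC

/-- Comparison of integrals over `[0,1]`, where the smaller function need not be integrable because
the larger one has a nonnegative integral. -/
theorem integral_le_of_le [FullLaw μ] {v w : ℝ → ℝ} (hw : Integrable w μ)
    (hw0 : 0 ≤ ∫ x, w x ∂μ) (h : ∀ x ∈ Icc (0 : ℝ) 1, v x ≤ w x) :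
    ∫ x, v x ∂μ ≤ ∫ x, w x ∂μ := by
  by_cases hv : Integrable v μ
  · exact integral_mono_ae hv hw ((FullLaw.ae_mem (μ := μ)).mono h)
  · rwa [integral_undef hv]

theorem integral_congr_Icc [FullLaw μ] {v w : ℝ → ℝ} (h : ∀ x ∈ Icc (0 : ℝ) 1, v x = w x) :
    ∫ x, v x ∂μ = ∫ x, w x ∂μ :=
  integral_congr_ae ((FullLaw.ae_mem (μ := μ)).mono h)

/-- The mean of a full law lies strictly between `0` and `1`. -/
theorem mean_mem_Ioo [FullLaw μ] : ∫ x, x ∂μ ∈ Ioo (0 : ℝ) 1 := by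
  have hi : Integrable (fun x : ℝ => x) μ := integrable_of_continuous continuous_id
  have hP : μ (Ioo 0 1) = 1 := by
    rw [prob_compl_eq_zero_iff measurableSet_Ioo |>.symm]
    have h0 : ∀ᵐ x ∂μ, x ≠ 0 := by simp [ae_iff]
    have h1 : ∀ᵐ x ∂μ, x ≠ 1 := by simp [ae_iff]
    have : ∀ᵐ x ∂μ, x ∈ Ioo (0 : ℝ) 1 := by
      filter_upwards [FullLaw.ae_mem (μ := μ), h0, h1] with x hx hx0 hx1
      exact ⟨lt_of_le_of_ne hx.1 hx0.symm, lt_of_le_of_ne hx.2 hx1⟩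
    exact this
  have hae : ∀ᵐ x ∂μ, x ∈ Ioo (0 : ℝ) 1 := (prob_compl_eq_zero_iff measurableSet_Ioo).2 hP
  constructor
  · rw [integral_pos_iff_support_of_nonneg_ae (hae.mono fun x hx => hx.1.le) hi]
    exact (FullLaw.pos (μ := μ) 0 1 le_rfl one_pos le_rfl).trans_le
      (measure_mono fun x hx => hx.1.ne')
  · have hi' : Integrable (fun x : ℝ => 1 - x) μ := (integrable_const 1).sub hi
    have : 0 < ∫ x, (1 - x) ∂μ := by
      rw [integral_pos_iff_support_of_nonneg_ae (hae.mono fun x hx => sub_nonneg.2 hx.2.le) hi']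
      exact (FullLaw.pos (μ := μ) 0 1 le_rfl one_pos le_rfl).trans_le
        (measure_mono fun x hx => (sub_pos.2 hx.2).ne')
    rw [integral_sub (integrable_const 1) hi] at this
    simpa using this

/-! ### Envelope formula -/

theorem monotoneOn_of_subgradient {U s : ℝ → ℝ}
    (h : ∀ x ∈ Icc (0 : ℝ) 1, ∀ y ∈ Icc (0 : ℝ) 1, U x + (y - x) * s x ≤ U y) :
    MonotoneOn s (Icc 0 1) := by
  intro x hx y hy hxy
  rcases hxy.eq_or_lt with rfl | hlt
  · exact le_rfl
  have h1 := h x hx y hy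
  have h2 := h y hy x hx
  have : (y - x) * s x ≤ (y - x) * s y := by linarith
  exact le_of_mul_le_mul_left this (sub_pos.2 hlt)

theorem intervalIntegrable_of_monotoneOn {s : ℝ → ℝ} (hs : MonotoneOn s (Icc 0 1)) {a b : ℝ}
    (ha : a ∈ Icc (0 : ℝ) 1) (hb : b ∈ Icc (0 : ℝ) 1) : IntervalIntegrable s volume a b :=
  (hs.mono (uIcc_subset_Icc ha hb)).intervalIntegrable

theorem intervalIntegrable_of_antitoneOn {s : ℝ → ℝ} (hs : AntitoneOn s (Icc 0 1)) {a b : ℝ}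
    (ha : a ∈ Icc (0 : ℝ) 1) (hb : b ∈ Icc (0 : ℝ) 1) : IntervalIntegrable s volume a b :=
  (hs.mono (uIcc_subset_Icc ha hb)).intervalIntegrable

/-- Envelope formula: a function with a subgradient `s` on `[0,1]` is an integral of `s`. -/
theorem integral_subgradient {U s : ℝ → ℝ}
    (h : ∀ x ∈ Icc (0 : ℝ) 1, ∀ y ∈ Icc (0 : ℝ) 1, U x + (y - x) * s x ≤ U y)
    {a b : ℝ} (ha : a ∈ Icc (0 : ℝ) 1) (hb : b ∈ Icc (0 : ℝ) 1) :
    ∫ y in a..b, s y = U b - U a := by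
  have hmono := monotoneOn_of_subgradient h
  have h0 : (0 : ℝ) ∈ Icc (0 : ℝ) 1 := by simp
  have h1 : (1 : ℝ) ∈ Icc (0 : ℝ) 1 := by simp
  have key : ∀ x ∈ Icc (0 : ℝ) 1, ∀ y ∈ Icc (0 : ℝ) 1,
      |U y - U x - (y - x) * s x| ≤ |y - x| * |s y - s x| := by
    intro x hx y hy
    have e1 := h x hx y hy
    have e2 := h y hy x hx
    rw [← abs_mul, abs_of_nonneg (by linarith)]
    refine le_trans ?_ (le_abs_self _)
    nlinarith
  have hcont : ContinuousOn U (Icc 0 1) := by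
    have : LipschitzOnWith (Real.toNNReal (|s 0| + |s 1|)) U (Icc 0 1) := by
      refine LipschitzOnWith.of_dist_le_mul fun x hx y hy => ?_
      rw [Real.coe_toNNReal _ (by positivity), Real.dist_eq, Real.dist_eq]
      have bd : ∀ z ∈ Icc (0 : ℝ) 1, |s z| ≤ |s 0| + |s 1| := fun z hz => by
        have l1 := hmono h0 hz hz.1
        have l2 := hmono hz h1 hz.2
        rw [abs_le]
        constructor
        · linarith [neg_abs_le (s 0), abs_nonneg (s 1)]
        · linarith [le_abs_self (s 1), abs_nonneg (s 0)]
      have e1 := h x hx y hy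
      have e2 := h y hy x hx
      have m1 : |(y - x) * s x| ≤ (|s 0| + |s 1|) * |x - y| := by
        rw [abs_mul, abs_sub_comm, mul_comm]
        exact mul_le_mul_of_nonneg_right (bd x hx) (abs_nonneg _)
      have m2 : |(x - y) * s y| ≤ (|s 0| + |s 1|) * |x - y| := by
        rw [abs_mul, mul_comm]
        exact mul_le_mul_of_nonneg_right (bd y hy) (abs_nonneg _)
      rw [abs_le] at m1 m2 ⊢
      constructor <;> linarith [m1.1, m1.2, m2.1, m2.2]
    exact this.continuousOn
  refine integral_eq_of_hasDerivAt_off_countable U s hmono.countable_not_continuousWithinAt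
    (hcont.mono (uIcc_subset_Icc ha hb)) ?_ (intervalIntegrable_of_monotoneOn hmono ha hb)
  intro x hx
  have hx01 : x ∈ Ioo (0 : ℝ) 1 :=
    ⟨(le_min ha.1 hb.1).trans_lt hx.1.1, hx.1.2.trans_le (max_le ha.2 hb.2)⟩
  have hxI := Ioo_subset_Icc_self hx01
  have hcx : ContinuousAt s x := by
    have : ContinuousWithinAt s (Icc 0 1) x := by
      by_contra hc
      exact hx.2 ⟨hxI, hc⟩
    exact this.continuousAt (Icc_mem_nhds hx01.1 hx01.2)
  rw [hasDerivAt_iff_tendsto]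
  have hlim : Tendsto (fun y => |s y - s x|) (𝓝 x) (𝓝 0) := by
    have := (hcx.sub (continuousAt_const (y := s x))).abs
    simpa [ContinuousAt] using this
  refine squeeze_zero' (Eventually.of_forall fun y => by positivity) ?_ hlim
  filter_upwards [Icc_mem_nhds hx01.1 hx01.2] with y hy
  rcases eq_or_ne y x with rfl | hne
  · simp
  have hpos : 0 < |y - x| := abs_pos.2 (sub_ne_zero.2 hne)
  rw [Real.norm_eq_abs, Real.norm_eq_abs, smul_eq_mul, inv_mul_le_iff₀ hpos]
  exact key x hxI y hy

/-! ### Screening with monotone allocations -/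

/-- For the allocation that serves the types in an upper set `J` with infimum `p`, the revenue
`α θ q θ - ∫₀^θ γ q` collected from a served type is `α p`, whatever the type. -/
theorem exists_threshold_of_upperSet [FullLaw μ] {α γ : ℝ → ℝ}
    (hα : ∀ p ∈ Icc (0 : ℝ) 1, ∀ θ ∈ Icc (0 : ℝ) 1, p ≤ θ → ∫ y in p..θ, γ y = α θ - α p)
    (hγ : IntervalIntegrable γ volume 0 1)
    {J : Set ℝ} (hJ : J ⊆ Icc 0 1)
    (hup : ∀ x ∈ J, ∀ y ∈ Icc (0 : ℝ) 1, x ≤ y → y ∈ J) :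
    ∃ p ∈ Icc (0 : ℝ) 1, J =ᵐ[μ] Ici p ∧ ∀ θ ∈ Icc (0 : ℝ) 1,
      α θ * J.indicator 1 θ - ∫ y in (0 : ℝ)..θ, γ y * J.indicator 1 y
        = α p * J.indicator 1 θ := by
  have hzero : ∀ θ : ℝ, 0 ≤ θ → (∀ y, 0 < y → y < θ → y ∉ J) →
      ∫ y in (0 : ℝ)..θ, γ y * J.indicator 1 y = 0 := by
    intro θ hθ hn
    rw [intervalIntegral.integral_of_le hθ, integral_Ioc_eq_integral_Ioo]
    refine setIntegral_eq_zero_of_forall_eq_zero fun y hy => ?_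
    rw [indicator_of_notMem (hn y hy.1 hy.2), mul_zero]
  rcases J.eq_empty_or_nonempty with rfl | hne
  · refine ⟨1, by simp, ?_, fun θ _ => by simp⟩
    have : μ.real (Ici 1) = 0 := demand_of_one_le le_rfl
    rw [measureReal_eq_zero_iff] at this
    exact (ae_eq_empty.2 this).symm
  have hbdd : BddBelow J := ⟨0, fun x hx => (hJ hx).1⟩
  obtain ⟨z, hz⟩ := hne
  have hp : sInf J ∈ Icc (0 : ℝ) 1 :=
    ⟨le_csInf ⟨z, hz⟩ fun x hx => (hJ hx).1, (csInf_le hbdd hz).trans (hJ hz).2⟩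
  have habove : ∀ y ∈ Icc (0 : ℝ) 1, sInf J < y → y ∈ J := by
    intro y hy hlt
    obtain ⟨x, hx, hxy⟩ := exists_lt_of_csInf_lt ⟨z, hz⟩ hlt
    exact hup x hx y hy hxy.le
  refine ⟨sInf J, hp, ?_, ?_⟩
  · have hne' : ∀ᵐ x ∂μ, x ≠ sInf J := by simp [ae_iff]
    filter_upwards [FullLaw.ae_mem (μ := μ), hne'] with x hx hxp
    refine propext ⟨fun h => csInf_le hbdd h, fun h => ?_⟩
    exact habove x hx (lt_of_le_of_ne h hxp.symm)
  · intro θ hθ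
    by_cases hθJ : θ ∈ J
    · have hpθ : sInf J ≤ θ := csInf_le hbdd hθJ
      have hγJ : ∀ y, sInf J < y → y < θ → γ y * J.indicator 1 y = γ y := fun y hy1 hy2 => by
        rw [indicator_of_mem (habove y ⟨hp.1.trans hy1.le, hy2.le.trans hθ.2⟩ hy1)]
        simp
      have hJm : MeasurableSet J := by
        refine OrdConnected.measurableSet ⟨fun x hx y hy w hw => ?_⟩
        exact hup x hx w ⟨(hJ hx).1.trans hw.1, hw.2.trans (hJ hy).2⟩ hw.1
      have hint : ∀ a ∈ Icc (0 : ℝ) 1, ∀ b ∈ Icc (0 : ℝ) 1,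
          IntervalIntegrable (fun y => γ y * J.indicator 1 y) volume a b := by
        intro a ha b hb
        have : (fun y => γ y * J.indicator 1 y) = J.indicator γ := by
          ext y
          by_cases hy : y ∈ J <;> simp [hy]
        rw [this]
        have hγab : IntervalIntegrable γ volume a b :=
          hγ.mono_set (by rw [uIcc_of_le zero_le_one]; exact uIcc_subset_Icc ha hb)
        exact ⟨hγab.1.indicator hJm, hγab.2.indicator hJm⟩
      rw [indicator_of_mem hθJ, Pi.one_apply, mul_one, mul_one,
        ← intervalIntegral.integral_add_adjacent_intervals (hint 0 (by simp) _ hp)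
          (hint _ hp θ hθ), hzero _ hp.1 fun y _ hy hyJ => (csInf_le hbdd hyJ).not_gt hy,
        zero_add, intervalIntegral.integral_of_le hpθ, integral_Ioc_eq_integral_Ioo,
        setIntegral_congr_fun measurableSet_Ioo fun y hy => hγJ y hy.1 hy.2,
        ← integral_Ioc_eq_integral_Ioo, ← intervalIntegral.integral_of_le hpθ,
        hα _ hp θ hθ hpθ]
      ring
    · rw [indicator_of_notMem hθJ, hzero θ hθ.1 fun y hy0 hy hyJ =>
        hθJ (hup y hyJ θ hθ hy.le)]
      simp

/-- The number of naturals `i < N` with `i < t` exceeds `t` by less than one. -/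
theorem sum_indicator_lt {N : ℕ} {t : ℝ} (ht0 : 0 ≤ t) (ht : t ≤ N) :
    t ≤ ∑ i ∈ Finset.range N, (if (i : ℝ) < t then (1 : ℝ) else 0) ∧
      ∑ i ∈ Finset.range N, (if (i : ℝ) < t then (1 : ℝ) else 0) ≤ t + 1 := by
  have h : (Finset.range N).filter (fun i : ℕ => (i : ℝ) < t) = Finset.range ⌈t⌉₊ := by
    ext i
    simp only [Finset.mem_filter, Finset.mem_range, Nat.lt_ceil, and_iff_right_iff_imp]
    intro hi
    exact_mod_cast hi.trans_le ht
  rw [Finset.sum_boole, h, Finset.card_range]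
  exact ⟨Nat.le_ceil t, (Nat.ceil_lt_add_one ht0).le⟩

/-- No monotone allocation beats the best threshold: if serving all types above `p` at the uniform
revenue `α p` never yields more than `M`, then the revenue `α θ q θ - ∫₀^θ γ q` of a monotone
allocation `q`, averaged over the types, is at most `M`.  Up to `O(1/N)`, `q` is the average of the
indicators of the upper sets `{q > i/N}`, and the revenue is linear in `q`. -/
theorem integral_le_of_threshold_bound [FullLaw μ] {α γ q v : ℝ → ℝ} {M : ℝ}
    (hα : ∀ p ∈ Icc (0 : ℝ) 1, ∀ θ ∈ Icc (0 : ℝ) 1, p ≤ θ → ∫ y in p..θ, γ y = α θ - α p)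
    (hγ : IntervalIntegrable γ volume 0 1) (hγ1 : ∀ y ∈ Icc (0 : ℝ) 1, |γ y| ≤ 1)
    (hq : MonotoneOn q (Icc 0 1)) (hq01 : ∀ y ∈ Icc (0 : ℝ) 1, q y ∈ Icc (0 : ℝ) 1)
    (hM0 : 0 ≤ M) (hM : ∀ p ∈ Icc (0 : ℝ) 1, demand μ p * α p ≤ M)
    (hv : ∀ θ ∈ Icc (0 : ℝ) 1, v θ ≤ α θ * q θ - ∫ y in (0 : ℝ)..θ, γ y * q y) :
    ∫ θ, v θ ∂μ ≤ M := by
  have h0 : (0 : ℝ) ∈ Icc (0 : ℝ) 1 := by simp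
  have hαbd : ∀ θ ∈ Icc (0 : ℝ) 1, |α θ| ≤ |α 0| + 1 := by
    intro θ hθ
    have h1 : |∫ y in (0 : ℝ)..θ, γ y| ≤ 1 * |θ - 0| := by
      rw [← Real.norm_eq_abs]
      refine intervalIntegral.norm_integral_le_of_norm_le_const fun y hy => ?_
      rw [uIoc_of_le hθ.1] at hy
      exact hγ1 y ⟨hy.1.le, hy.2.trans hθ.2⟩
    rw [hα 0 h0 θ hθ hθ.1, sub_zero, one_mul, abs_of_nonneg hθ.1] at h1
    have h2 := abs_add_le (α θ - α 0) (α 0)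
    rw [sub_add_cancel] at h2
    linarith [hθ.2]
  have main : ∀ N : ℕ, 0 < N → ∫ θ, v θ ∂μ ≤ M + (|α 0| + 2) / N := by
    intro N hN
    have hNR : (0 : ℝ) < N := by exact_mod_cast hN
    set J : ℕ → Set ℝ := fun i => {y | y ∈ Icc (0 : ℝ) 1 ∧ (i : ℝ) < N * q y} with hJdef
    have hJsub : ∀ i, J i ⊆ Icc 0 1 := fun i y hy => hy.1
    have hJup : ∀ i, ∀ x ∈ J i, ∀ y ∈ Icc (0 : ℝ) 1, x ≤ y → y ∈ J i := fun i x hx y hy hxy =>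
      ⟨hy, hx.2.trans_le (mul_le_mul_of_nonneg_left (hq hx.1 hy hxy) hNR.le)⟩
    have hJm : ∀ i, MeasurableSet (J i) := fun i => by
      refine OrdConnected.measurableSet ⟨fun x hx y hy w hw => ?_⟩
      exact hJup i x hx w ⟨hx.1.1.trans hw.1, hw.2.trans hy.1.2⟩ hw.1
    choose p hp hpJ hpθ using fun i =>
      exists_threshold_of_upperSet (μ := μ) hα hγ (hJsub i) (hJup i)
    have hsum : ∀ y ∈ Icc (0 : ℝ) 1, N * q y ≤ ∑ i ∈ Finset.range N, (J i).indicator 1 y ∧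
        ∑ i ∈ Finset.range N, (J i).indicator 1 y ≤ N * q y + 1 := by
      intro y hy
      have e : ∀ i : ℕ, (J i).indicator (1 : ℝ → ℝ) y = if (i : ℝ) < N * q y then 1 else 0 := by
        intro i
        simp only [indicator, hJdef, mem_ofPred_eq, hy, true_and, Pi.one_apply]
      simp_rw [e]
      refine sum_indicator_lt (mul_nonneg hNR.le (hq01 y hy).1) ?_
      exact mul_le_of_le_one_right hNR.le (hq01 y hy).2
    have hγq : ∀ θ ∈ Icc (0 : ℝ) 1, IntervalIntegrable (fun y => γ y * q y) volume 0 θ := by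
      intro θ hθ
      have h1 : IntervalIntegrable γ volume 0 θ :=
        hγ.mono_set (by rw [uIcc_of_le zero_le_one]; exact uIcc_subset_Icc h0 hθ)
      have h2 := intervalIntegrable_of_monotoneOn hq h0 hθ
      rw [intervalIntegrable_iff] at h1 h2 ⊢
      refine h1.mul_bdd (c := 1) h2.aestronglyMeasurable ?_
      refine (ae_restrict_iff' measurableSet_uIoc).2 (Eventually.of_forall fun y hy => ?_)
      rw [uIoc_of_le hθ.1] at hy
      have := hq01 y ⟨hy.1.le, hy.2.trans hθ.2⟩
      rw [Real.norm_eq_abs, abs_of_nonneg this.1]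
      exact this.2
    have hγJ : ∀ i, ∀ θ ∈ Icc (0 : ℝ) 1,
        IntervalIntegrable (fun y => γ y * (J i).indicator 1 y) volume 0 θ := by
      intro i θ hθ
      have h1 : IntervalIntegrable γ volume 0 θ :=
        hγ.mono_set (by rw [uIcc_of_le zero_le_one]; exact uIcc_subset_Icc h0 hθ)
      have e : (fun y => γ y * (J i).indicator 1 y) = (J i).indicator γ := by
        ext y
        by_cases hy : y ∈ J i <;> simp [hy]
      rw [e]
      exact ⟨h1.1.indicator (hJm i), h1.2.indicator (hJm i)⟩
    set w : ℝ → ℝ := fun θ =>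
      (|α 0| + 2) / N + (∑ i ∈ Finset.range N, α (p i) * (J i).indicator 1 θ) / N with hw
    have hvw : ∀ θ ∈ Icc (0 : ℝ) 1, v θ ≤ w θ := by
      intro θ hθ
      refine (hv θ hθ).trans ?_
      have e1 : ∑ i ∈ Finset.range N, α (p i) * (J i).indicator 1 θ
          = α θ * (∑ i ∈ Finset.range N, (J i).indicator 1 θ)
            - ∫ y in (0 : ℝ)..θ, γ y * ∑ i ∈ Finset.range N, (J i).indicator 1 y := by
        simp_rw [← hpθ _ θ hθ, Finset.sum_sub_distrib, Finset.mul_sum]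
        rw [intervalIntegral.integral_finsetSum fun i _ => hγJ i θ hθ]
      have hγS : IntervalIntegrable
          (fun y => γ y * ∑ i ∈ Finset.range N, (J i).indicator 1 y) volume 0 θ := by
        simp_rw [Finset.mul_sum]
        have := IntervalIntegrable.sum (Finset.range N) fun i (_ : i ∈ Finset.range N) =>
          hγJ i θ hθ
        refine this.congr ?_
        exact fun y _ => by simp
      have e2 : |(∫ y in (0 : ℝ)..θ, γ y * ∑ i ∈ Finset.range N, (J i).indicator 1 y)
          - N * ∫ y in (0 : ℝ)..θ, γ y * q y| ≤ 1 * |θ - 0| := by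
        rw [← intervalIntegral.integral_const_mul,
          ← intervalIntegral.integral_sub hγS ((hγq θ hθ).const_mul _), ← Real.norm_eq_abs]
        refine intervalIntegral.norm_integral_le_of_norm_le_const fun y hy => ?_
        rw [uIoc_of_le hθ.1] at hy
        have hy' : y ∈ Icc (0 : ℝ) 1 := ⟨hy.1.le, hy.2.trans hθ.2⟩
        have hs := hsum y hy'
        have e : γ y * (∑ i ∈ Finset.range N, (J i).indicator 1 y) - N * (γ y * q y)
            = γ y * ((∑ i ∈ Finset.range N, (J i).indicator 1 y) - N * q y) := by ring
        rw [Real.norm_eq_abs, e, abs_mul]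
        refine mul_le_one₀ (hγ1 y hy') (abs_nonneg _) ?_
        rw [abs_le]
        constructor <;> linarith [hs.1, hs.2]
      rw [sub_zero, one_mul, abs_of_nonneg hθ.1] at e2
      have e3 : |α θ * ((∑ i ∈ Finset.range N, (J i).indicator 1 θ) - N * q θ)|
          ≤ |α 0| + 1 := by
        have hs := hsum θ hθ
        rw [abs_mul]
        refine (mul_le_of_le_one_right (abs_nonneg _) ?_).trans (hαbd θ hθ)
        rw [abs_le]
        constructor <;> linarith [hs.1, hs.2]
      rw [hw]
      simp only
      rw [← add_div, le_div_iff₀ hNR, e1]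
      have e2' := (abs_le.1 e2)
      have e3' := (abs_le.1 e3)
      nlinarith [e2'.1, e2'.2, e3'.1, e3'.2, hθ.2]
    have hind : ∀ i, Integrable (fun θ => α (p i) * (J i).indicator (1 : ℝ → ℝ) θ) μ := fun i =>
      ((integrable_const (1 : ℝ)).indicator (hJm i)).const_mul _
    have hind' : Integrable
        (fun θ => (∑ i ∈ Finset.range N, α (p i) * (J i).indicator (1 : ℝ → ℝ) θ) / N) μ :=
      (integrable_finsetSum _ fun i _ => hind i).div_const _
    have hwint : Integrable w μ := (integrable_const _).add hind'
    have hwle : ∫ θ, w θ ∂μ ≤ M + (|α 0| + 2) / N := by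
      rw [hw, integral_add (integrable_const _) hind',
        integral_div (N : ℝ) (fun θ => ∑ i ∈ Finset.range N, α (p i) * (J i).indicator 1 θ),
        integral_finsetSum _ fun i _ => hind i]
      have e : ∀ i ∈ Finset.range N, ∫ θ, α (p i) * (J i).indicator (1 : ℝ → ℝ) θ ∂μ ≤ M := by
        intro i _
        rw [integral_const_mul, integral_indicator_one (hJm i), measureReal_congr (hpJ i),
          mul_comm]
        exact hM _ (hp i)
      have := Finset.sum_le_sum e
      rw [Finset.sum_const, Finset.card_range, nsmul_eq_mul] at this
      have h2 : (∑ i ∈ Finset.range N, ∫ θ, α (p i) * (J i).indicator (1 : ℝ → ℝ) θ ∂μ) / N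
          ≤ M := by
        rw [div_le_iff₀ hNR]
        linarith
      simp only [integral_const, probReal_univ, one_smul]
      linarith
    by_cases hvi : Integrable v μ
    · exact (integral_mono_ae hvi hwint ((FullLaw.ae_mem (μ := μ)).mono hvw)).trans hwle
    · rw [integral_undef hvi]
      positivity
  refine ge_of_tendsto (x := atTop) (f := fun N : ℕ => M + (|α 0| + 2) / N) ?_ ?_
  · have := (tendsto_const_div_atTop_nhds_zero_nat (|α 0| + 2)).const_add M
    simpa using this
  · filter_upwards [eventually_gt_atTop 0] with N hN using main N hN

/-! ### Ex-post incentive compatible mechanisms -/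

section Mechanism

variable {q t : ℝ → ℝ → ℝ}

/-- The buyer's utility in a direct mechanism. -/
def buyerUtility (q t : ℝ → ℝ → ℝ) (θ ω : ℝ) : ℝ := θ * q θ ω - t θ ω

theorem BuyerFeasible.subgradient (h : BuyerFeasible q t) {ω : ℝ} (hω : ω ∈ Icc (0 : ℝ) 1) :
    ∀ x ∈ Icc (0 : ℝ) 1, ∀ y ∈ Icc (0 : ℝ) 1,
      buyerUtility q t x ω + (y - x) * q x ω ≤ buyerUtility q t y ω := by
  intro x hx y hy
  have := h.truthful y hy x hx ω hω
  simp only [buyerUtility]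
  linarith

theorem SellerTruthful.subgradient (h : SellerTruthful q t) {θ : ℝ} (hθ : θ ∈ Icc (0 : ℝ) 1) :
    ∀ x ∈ Icc (0 : ℝ) 1, ∀ y ∈ Icc (0 : ℝ) 1,
      sellerPayoff q t (θ, x) + (y - x) * (-q θ x) ≤ sellerPayoff q t (θ, y) := by
  intro x hx y hy
  have := h θ hθ y hy x hx
  simp only [sellerPayoff]
  linarith

theorem sellerPayoff_eq (θ ω : ℝ) :
    sellerPayoff q t (θ, ω) = (θ - ω) * q θ ω - buyerUtility q t θ ω := by
  simp only [sellerPayoff, buyerUtility]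
  ring

/-- Uniqueness for a Volterra equation: a bounded solution of
`(θ - ω) e(ω, θ) = ∫ₐ^θ e(ω, y) dy + ∫_ω^b e(z, θ) dz` on `[0, b] × [a, 1]`, where `b < a`, is zero.
With `s = (θ - a) + (b - ω)`, iteration gives `|e| ≤ K (2 s / (a - b))^n / n!` for all `n`. -/
theorem volterra_eq_zero {a b K : ℝ} {e : ℝ → ℝ → ℝ} (hba : b < a)
    (hK : ∀ ω ∈ Icc 0 b, ∀ θ ∈ Icc a 1, |e ω θ| ≤ K)
    (he : ∀ ω ∈ Icc 0 b, ∀ θ ∈ Icc a 1,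
      (θ - ω) * e ω θ = (∫ y in a..θ, e ω y) + ∫ z in ω..b, e z θ) :
    ∀ ω ∈ Icc 0 b, ∀ θ ∈ Icc a 1, e ω θ = 0 := by
  have hg : 0 < a - b := sub_pos.2 hba
  have main : ∀ n : ℕ, ∀ ω ∈ Icc 0 b, ∀ θ ∈ Icc a 1,
      |e ω θ| ≤ K * ((2 / (a - b)) ^ n / n.factorial) * (θ + (b - ω - a)) ^ n := by
    intro n
    induction n with
    | zero => simpa using hK
    | succ n ih =>
      intro ω hω θ hθ
      have hK0 : 0 ≤ K := (abs_nonneg _).trans (hK ω hω θ hθ)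
      set c : ℝ := K * ((2 / (a - b)) ^ n / n.factorial) with hc
      have hc0 : 0 ≤ c := by positivity
      set s : ℝ := θ + (b - ω - a) with hs
      have hs0 : 0 ≤ s := by rw [hs]; linarith [hω.2, hθ.1]
      have i1 : |∫ y in a..θ, e ω y| ≤ c * (s ^ (n + 1) / (n + 1)) := by
        have h1 : |∫ y in a..θ, e ω y| ≤ ∫ y in a..θ, c * (y + (b - ω - a)) ^ n := by
          rw [← Real.norm_eq_abs]
          refine intervalIntegral.norm_integral_le_of_norm_le hθ.1 ?_ ?_
          · exact Eventually.of_forall fun y hy => ih ω hω y ⟨hy.1.le, hy.2.trans hθ.2⟩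
          · exact Continuous.intervalIntegrable (by fun_prop) _ _
        refine h1.trans ?_
        rw [intervalIntegral.integral_const_mul,
          intervalIntegral.integral_comp_add_right (fun u => u ^ n), integral_pow]
        refine mul_le_mul_of_nonneg_left ?_ hc0
        refine div_le_div_of_nonneg_right ?_ (by positivity)
        have : 0 ≤ (a + (b - ω - a)) ^ (n + 1) := pow_nonneg (by linarith [hω.2]) _
        linarith
      have i2 : |∫ z in ω..b, e z θ| ≤ c * (s ^ (n + 1) / (n + 1)) := by
        have h1 : |∫ z in ω..b, e z θ| ≤ ∫ z in ω..b, c * ((θ + b - a) - z) ^ n := by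
          rw [← Real.norm_eq_abs]
          refine intervalIntegral.norm_integral_le_of_norm_le hω.2 ?_ ?_
          · refine Eventually.of_forall fun z hz => ?_
            have := ih z ⟨hω.1.trans hz.1.le, hz.2⟩ θ hθ
            rwa [show θ + (b - z - a) = (θ + b - a) - z by ring] at this
          · exact Continuous.intervalIntegrable (by fun_prop) _ _
        refine h1.trans ?_
        rw [intervalIntegral.integral_const_mul,
          intervalIntegral.integral_comp_sub_left (fun u => u ^ n), integral_pow]
        refine mul_le_mul_of_nonneg_left ?_ hc0
        refine div_le_div_of_nonneg_right ?_ (by positivity)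
        have h2 : 0 ≤ (θ + b - a - b) ^ (n + 1) := pow_nonneg (by linarith [hθ.1]) _
        rw [show θ + b - a - ω = s by rw [hs]; ring]
        linarith
      have h3 : (a - b) * |e ω θ| ≤ 2 * (c * (s ^ (n + 1) / (n + 1))) := by
        have h4 : |(θ - ω) * e ω θ| ≤ 2 * (c * (s ^ (n + 1) / (n + 1))) := by
          rw [he ω hω θ hθ]
          exact (abs_add_le _ _).trans (by linarith)
        rw [abs_mul, abs_of_nonneg (by linarith [hω.2, hθ.1])] at h4
        refine le_trans (mul_le_mul_of_nonneg_right ?_ (abs_nonneg _)) h4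
        linarith [hω.2, hθ.1]
      rw [mul_comm, ← le_div_iff₀ hg] at h3
      refine h3.trans (le_of_eq ?_)
      have hr : ∀ X : ℝ, 2 * X / (a - b) = 2 / (a - b) * X := fun X => by ring
      rw [hr, hc, Nat.factorial_succ]
      generalize 2 / (a - b) = r
      push_cast
      field_simp
      ring
  intro ω hω θ hθ
  have hlim : Tendsto (fun n : ℕ => K * ((2 / (a - b)) ^ n / n.factorial) *
      (θ + (b - ω - a)) ^ n) atTop (𝓝 0) := by
    have := (FloorSemiring.tendsto_pow_div_factorial_atTop
      ((2 / (a - b)) * (θ + (b - ω - a)))).const_mul K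
    rw [mul_zero] at this
    refine this.congr fun n => ?_
    rw [mul_pow]
    ring
  exact abs_nonpos_iff.1 (ge_of_tendsto' hlim fun n => main n ω hω θ hθ)

/-- Above the diagonal, an allocation that is incentive compatible ex post for both sides is
additively separable: its cross differences vanish. -/
theorem allocation_cross_difference (hB : BuyerFeasible q t) (hS : SellerTruthful q t)
    {ω b a θ : ℝ} (hω : 0 ≤ ω) (hωb : ω ≤ b) (hba : b < a) (haθ : a ≤ θ) (hθ : θ ≤ 1) :
    q θ ω - q θ b = q a ω - q a b := by
  have haI : a ∈ Icc (0 : ℝ) 1 := ⟨by linarith, by linarith⟩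
  have hbI : b ∈ Icc (0 : ℝ) 1 := ⟨by linarith, by linarith⟩
  have hz := volterra_eq_zero (e := fun ω θ => (q θ ω - q θ b) - (q a ω - q a b)) (K := 2) hba
    ?_ ?_ ω ⟨hω, hωb⟩ θ ⟨haθ, hθ⟩
  · exact sub_eq_zero.1 hz
  · intro ω hω θ hθ
    have hωI : ω ∈ Icc (0 : ℝ) 1 := ⟨hω.1, hω.2.trans hbI.2⟩
    have hθI : θ ∈ Icc (0 : ℝ) 1 := ⟨haI.1.trans hθ.1, hθ.2⟩
    have h1 := hB.q_mem θ hθI ω hωI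
    have h2 := hB.q_mem θ hθI b hbI
    have h3 := hB.q_mem a haI ω hωI
    have h4 := hB.q_mem a haI b hbI
    rw [abs_le]
    constructor <;> linarith [h1.1, h1.2, h2.1, h2.2, h3.1, h3.2, h4.1, h4.2]
  · intro ω hω θ hθ
    have hωI : ω ∈ Icc (0 : ℝ) 1 := ⟨hω.1, hω.2.trans hbI.2⟩
    have hθI : θ ∈ Icc (0 : ℝ) 1 := ⟨haI.1.trans hθ.1, hθ.2⟩
    have bI : ∀ z ∈ Icc (0 : ℝ) 1, IntervalIntegrable (fun y => q y z) volume a θ :=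
      fun z hz => intervalIntegrable_of_monotoneOn
        (monotoneOn_of_subgradient (hB.subgradient hz)) haI hθI
    have sI : ∀ x ∈ Icc (0 : ℝ) 1, IntervalIntegrable (fun z => q x z) volume ω b :=
      fun x hx => intervalIntegrable_of_antitoneOn (fun y hy z hz hyz => neg_le_neg_iff.1
        (monotoneOn_of_subgradient (hS.subgradient hx) hy hz hyz)) hωI hbI
    have b1 := integral_subgradient (hB.subgradient hωI) haI hθI
    have b2 := integral_subgradient (hB.subgradient hbI) haI hθI
    have s1 := integral_subgradient (hS.subgradient hθI) hωI hbI
    have s2 := integral_subgradient (hS.subgradient haI) hωI hbI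
    rw [intervalIntegral.integral_neg] at s1 s2
    simp only [sellerPayoff_eq] at s1 s2
    have f1 : ∫ y in a..θ, (q y ω - q y b - (q a ω - q a b))
        = (∫ y in a..θ, q y ω) - (∫ y in a..θ, q y b) - (θ - a) * (q a ω - q a b) := by
      rw [intervalIntegral.integral_sub ((bI ω hωI).sub (bI b hbI)) intervalIntegrable_const,
        intervalIntegral.integral_sub (bI ω hωI) (bI b hbI), intervalIntegral.integral_const,
        smul_eq_mul]
    have f2 : ∫ z in ω..b, (q θ z - q θ b - (q a z - q a b))
        = (∫ z in ω..b, q θ z) - (∫ z in ω..b, q a z) - (b - ω) * (q θ b - q a b) := by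
      rw [← intervalIntegral.integral_sub (sI θ hθI) (sI a haI), ← smul_eq_mul,
        ← intervalIntegral.integral_const, ← intervalIntegral.integral_sub
          ((sI θ hθI).sub (sI a haI)) intervalIntegrable_const]
      refine intervalIntegral.integral_congr fun z _ => ?_
      ring
    rw [f1, f2, b1, b2]
    linear_combination s1 - s2

/-- The seller's payoff is bounded in terms of the allocation and the buyer's utility at the
lowest cost. -/
theorem sellerPayoff_le_of_lt (hB : BuyerFeasible q t) (hS : SellerTruthful q t) {θ ω : ℝ}
    (hω : 0 ≤ ω) (hωθ : ω < θ) (hθ : θ ≤ 1) :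
    sellerPayoff q t (θ, ω)
      ≤ (θ - ω) * q θ 0 - (buyerUtility q t θ 0 - buyerUtility q t ω 0) := by
  have h0 : (0 : ℝ) ∈ Icc (0 : ℝ) 1 := by simp
  have hωI : ω ∈ Icc (0 : ℝ) 1 := ⟨hω, by linarith⟩
  have hθI : θ ∈ Icc (0 : ℝ) 1 := ⟨by linarith, hθ⟩
  have e1 := integral_subgradient (hB.subgradient hωI) hωI hθI
  have e2 := integral_subgradient (hB.subgradient h0) hωI hθI
  have i1 := intervalIntegrable_of_monotoneOn
    (monotoneOn_of_subgradient (hB.subgradient hωI)) hωI hθI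
  have i2 := intervalIntegrable_of_monotoneOn
    (monotoneOn_of_subgradient (hB.subgradient h0)) hωI hθI
  have e3 : ∫ y in ω..θ, (q y 0 - q y ω) = (θ - ω) * (q θ 0 - q θ ω) := by
    rw [intervalIntegral.integral_congr_Ioo_of_le (g := fun _ => q θ 0 - q θ ω) hωθ.le,
      intervalIntegral.integral_const, smul_eq_mul]
    intro y hy
    exact (allocation_cross_difference hB hS le_rfl hω hy.1 hy.2.le hθ).symm
  rw [intervalIntegral.integral_sub i2 i1] at e3
  have hp := hB.participation ω hωI ω hωI
  rw [sellerPayoff_eq]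
  simp only [buyerUtility] at *
  linarith

/-- The seller does not gain at costs above the buyer's value. -/
theorem sellerPayoff_nonpos (hB : BuyerFeasible q t) (hS : SellerTruthful q t) {θ ω : ℝ}
    (hθ : 0 ≤ θ) (hωθ : θ ≤ ω) (hω : ω ≤ 1) : sellerPayoff q t (θ, ω) ≤ 0 := by
  have hωI : ω ∈ Icc (0 : ℝ) 1 := ⟨by linarith, hω⟩
  have hθI : θ ∈ Icc (0 : ℝ) 1 := ⟨hθ, by linarith⟩
  have h1 := hB.participation θ hθI θ hθI
  have h2 := hS θ hθI θ hθI ω hωI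
  have h3 := (hB.q_mem θ hθI ω hωI).1
  simp only [sellerPayoff]
  nlinarith

/-- If `U` is convex and nondecreasing with subgradient `s ≥ 0`, then
`θ ↦ E[(U θ - U ω) 1_{ω ≤ θ}]` is an integral of `s` times the distribution function of `ω`. -/
theorem integral_cdf_mul_subgradient [FullLaw ν] {U s : ℝ → ℝ}
    (h : ∀ x ∈ Icc (0 : ℝ) 1, ∀ y ∈ Icc (0 : ℝ) 1, U x + (y - x) * s x ≤ U y)
    (hs : ∀ x ∈ Icc (0 : ℝ) 1, 0 ≤ s x) (hU : Measurable U) {a b : ℝ}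
    (ha : a ∈ Icc (0 : ℝ) 1) (hb : b ∈ Icc (0 : ℝ) 1) :
    ∫ y in a..b, ν.real (Iic y) * s y
      = (∫ ω, (Iic b).indicator (fun ω => U b - U ω) ω ∂ν)
        - ∫ ω, (Iic a).indicator (fun ω => U a - U ω) ω ∂ν := by
  have hUm : MonotoneOn U (Icc 0 1) := by
    intro x hx y hy hxy
    have := mul_nonneg (sub_nonneg.2 hxy) (hs x hx)
    linarith [h x hx y hy]
  have hint : ∀ x ∈ Icc (0 : ℝ) 1,
      Integrable ((Iic x).indicator (fun ω => U x - U ω)) ν := by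
    intro x hx
    refine integrable_of_bdd (C := U 1 - U 0)
      ((measurable_const.sub hU).indicator measurableSet_Iic).aestronglyMeasurable ?_
    intro ω hω
    have l0 := hUm (by simp) hω hω.1
    have l1 := hUm hx (by simp) hx.2
    have l2 := hUm (by simp) hx hx.1
    by_cases hωx : ω ≤ x
    · have := hUm hω hx hωx
      rw [indicator_of_mem (mem_Iic.2 hωx), abs_of_nonneg (by linarith)]
      linarith
    · rw [indicator_of_notMem (by simpa using hωx), abs_zero]
      linarith
  refine integral_subgradient (U := fun x => ∫ ω, (Iic x).indicator (fun ω => U x - U ω) ω ∂ν)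
    (s := fun y => ν.real (Iic y) * s y) ?_ ha hb
  intro x hx y hy
  have e : ν.real (Iic x) * s x = ∫ ω, (Iic x).indicator (fun _ => s x) ω ∂ν := by
    rw [integral_indicator_const _ measurableSet_Iic, smul_eq_mul]
  have i1 : Integrable ((Iic x).indicator fun _ => s x) ν :=
    (integrable_const _).indicator measurableSet_Iic
  rw [e, ← integral_const_mul, ← integral_add (hint x hx) (i1.const_mul _)]
  refine integral_mono_ae ((hint x hx).add (i1.const_mul _)) (hint y hy) ?_
  filter_upwards [FullLaw.ae_mem (μ := ν)] with ω hω
  have hxy := h x hx y hy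
  by_cases hωx : ω ≤ x
  · rw [indicator_of_mem (mem_Iic.2 hωx), indicator_of_mem (mem_Iic.2 hωx)]
    by_cases hωy : ω ≤ y
    · rw [indicator_of_mem (mem_Iic.2 hωy)]
      linarith
    · rw [indicator_of_notMem (by simpa using hωy)]
      have := hUm hy hω (not_le.1 hωy).le
      linarith
  · rw [indicator_of_notMem (by simpa using hωx), indicator_of_notMem (by simpa using hωx)]
    by_cases hωy : ω ≤ y
    · rw [indicator_of_mem (mem_Iic.2 hωy)]
      have := hUm hω hy hωy
      linarith
    · rw [indicator_of_notMem (by simpa using hωy)]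
      simp

/-- The expected gain `E[(p - ω)⁺]` of a seller who may sell at the price `p` at her option. -/
noncomputable def optionValue (ν : Measure ℝ) (p : ℝ) : ℝ := ∫ ω, max (p - ω) 0 ∂ν

theorem optionValue_eq (p : ℝ) :
    optionValue ν p = ∫ ω, (Iic p).indicator (fun ω => p - ω) ω ∂ν := by
  refine integral_congr_ae (Eventually.of_forall fun ω => ?_)
  by_cases h : ω ≤ p
  · simp [h]
  · simp [h, (not_le.1 h).le]

theorem optionValue_sub [FullLaw ν] {a b : ℝ} (ha : a ∈ Icc (0 : ℝ) 1) (hb : b ∈ Icc (0 : ℝ) 1) :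
    ∫ y in a..b, ν.real (Iic y) = optionValue ν b - optionValue ν a := by
  have := integral_cdf_mul_subgradient (ν := ν) (U := fun x => x) (s := fun _ => 1)
    (fun x _ y _ => by linarith) (fun _ _ => zero_le_one) measurable_id ha hb
  simpa only [mul_one, optionValue_eq] using this

theorem integrable_option [FullLaw ν] (p : ℝ) : Integrable (fun ω => max (p - ω) 0) ν :=
  integrable_of_continuous (by fun_prop)

theorem optionValue_nonneg (p : ℝ) : 0 ≤ optionValue ν p :=
  integral_nonneg fun _ => le_max_right _ _

theorem continuous_optionValue [FullLaw ν] : Continuous (optionValue ν) := by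
  refine (LipschitzWith.of_le_add (f := optionValue ν) fun x y => ?_).continuous
  have : optionValue ν y + dist x y = ∫ ω, (max (y - ω) 0 + dist x y) ∂ν := by
    rw [integral_add (integrable_option y) (integrable_const _)]
    simp [optionValue]
  rw [this]
  refine integral_mono (integrable_option x) ((integrable_option y).add (integrable_const _)) ?_
  intro ω
  have h1 : x - y ≤ dist x y := (le_abs_self _).trans_eq (Real.dist_eq x y).symm
  refine max_le ?_ ?_
  · linarith [le_max_left (y - ω) 0]
  · exact add_nonneg (le_max_right _ _) dist_nonneg

/-- Upper bound on the seller's profit when both sides are incentive compatible ex post: it does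
not exceed that of the best posted price at which either side may refuse to trade. -/
theorem directProfit_le_of_truthful [FullLaw μ] [FullLaw ν] (hB : BuyerFeasible q t)
    (hS : SellerTruthful q t) (hint : Integrable (sellerPayoff q t) (μ.prod ν)) {M : ℝ}
    (hM0 : 0 ≤ M) (hM : ∀ p ∈ Icc (0 : ℝ) 1, demand μ p * optionValue ν p ≤ M) :
    ∫ z, sellerPayoff q t z ∂(μ.prod ν) ≤ M := by
  have h0 : (0 : ℝ) ∈ Icc (0 : ℝ) 1 := by simp
  rw [integral_prod _ hint]
  have hq01 : ∀ y ∈ Icc (0 : ℝ) 1, q y 0 ∈ Icc (0 : ℝ) 1 := fun y hy => hB.q_mem y hy 0 h0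
  have hUmeas : Measurable fun θ => buyerUtility q t θ 0 := by
    have h1 : Measurable fun θ => q θ 0 := hB.measurable_q.of_uncurry_right
    have h2 : Measurable fun θ => t θ 0 := hB.measurable_t.of_uncurry_right
    exact (measurable_id.mul h1).sub h2
  have hsub := hB.subgradient h0
  refine integral_le_of_threshold_bound (α := optionValue ν) (γ := fun y => ν.real (Iic y))
    (q := fun θ => q θ 0) (fun p hp θ hθ _ => optionValue_sub hp hθ) ?_ ?_
    (monotoneOn_of_subgradient hsub) hq01 hM0 hM ?_
  · refine intervalIntegrable_of_monotoneOn (fun x _ y _ hxy => ?_) h0 (by simp)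
    exact measureReal_mono (Iic_subset_Iic.2 hxy)
  · intro y _
    rw [abs_of_nonneg measureReal_nonneg]
    exact measureReal_le_one
  · intro θ hθ
    have e := integral_cdf_mul_subgradient (ν := ν) hsub (fun x hx => (hq01 x hx).1) hUmeas
      h0 hθ
    have e0 : ∫ ω, (Iic (0 : ℝ)).indicator
        (fun ω => buyerUtility q t 0 0 - buyerUtility q t ω 0) ω ∂ν = 0 := by
      rw [integral_congr_Icc (w := fun _ => 0), integral_zero]
      intro ω hω
      by_cases h : ω ≤ 0
      · obtain rfl : ω = 0 := le_antisymm h hω.1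
        simp
      · simp [h]
    rw [e0, sub_zero] at e
    have hUm : ∀ ω ∈ Icc (0 : ℝ) 1, ω ≤ θ →
        0 ≤ buyerUtility q t θ 0 - buyerUtility q t ω 0 ∧
          buyerUtility q t θ 0 - buyerUtility q t ω 0 ≤ (θ - ω) * q θ 0 := by
      intro ω hω hωθ
      have h1 := hsub ω hω θ hθ
      have h2 := hsub θ hθ ω hω
      have := mul_nonneg (sub_nonneg.2 hωθ) (hq01 ω hω).1
      constructor <;> linarith
    have hint2 : Integrable ((Iic θ).indicator
        fun ω => buyerUtility q t θ 0 - buyerUtility q t ω 0) ν := by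
      refine integrable_of_bdd (C := 1)
        ((measurable_const.sub hUmeas).indicator measurableSet_Iic).aestronglyMeasurable ?_
      intro ω hω
      by_cases h : ω ≤ θ
      · have := hUm ω hω h
        have h3 : (θ - ω) * q θ 0 ≤ 1 :=
          mul_le_one₀ (by linarith [hθ.2, hω.1]) (hq01 θ hθ).1 (hq01 θ hθ).2
        rw [indicator_of_mem (mem_Iic.2 h), abs_of_nonneg this.1]
        linarith
      · simp [h]
    have e2 : optionValue ν θ * q θ 0 - ∫ y in (0 : ℝ)..θ, ν.real (Iic y) * q y 0
        = ∫ ω, (max (θ - ω) 0 * q θ 0 - (Iic θ).indicator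
          (fun ω => buyerUtility q t θ 0 - buyerUtility q t ω 0) ω) ∂ν := by
      rw [integral_sub ((integrable_option θ).mul_const _) hint2, integral_mul_const, e]
      rfl
    rw [e2]
    refine integral_le_of_le (((integrable_option θ).mul_const _).sub hint2) ?_ ?_
    · refine integral_nonneg_of_ae ((FullLaw.ae_mem (μ := ν)).mono fun ω hω => ?_)
      by_cases h : ω ≤ θ
      · have := hUm ω hω h
        simp only [Pi.zero_apply, indicator_of_mem (mem_Iic.2 h),
          max_eq_left (sub_nonneg.2 h)]
        linarith
      · simp [h, (not_le.1 h).le]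
    · intro ω hω
      rcases lt_or_ge ω θ with h | h
      · have := sellerPayoff_le_of_lt hB hS hω.1 h hθ.2
        simpa only [indicator_of_mem (mem_Iic.2 h.le), max_eq_left (sub_nonneg.2 h.le)] using this
      · have := sellerPayoff_nonpos hB hS hθ.1 h hω.2
        refine this.trans ?_
        rw [max_eq_right (sub_nonpos.2 h), zero_mul, zero_sub]
        by_cases h' : ω ≤ θ
        · obtain rfl : ω = θ := le_antisymm h' h
          simp
        · simp [h']

/-- At each cost, no mechanism that respects the buyer's constraints beats the best price. -/
theorem integral_sellerPayoff_le [FullLaw μ] (hB : BuyerFeasible q t) {ω M : ℝ}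
    (hω : ω ∈ Icc (0 : ℝ) 1) (hM0 : 0 ≤ M)
    (hM : ∀ p ∈ Icc (0 : ℝ) 1, demand μ p * (p - ω) ≤ M) :
    ∫ θ, sellerPayoff q t (θ, ω) ∂μ ≤ M := by
  have h0 : (0 : ℝ) ∈ Icc (0 : ℝ) 1 := by simp
  refine integral_le_of_threshold_bound (α := fun θ => θ - ω) (γ := fun _ => 1)
    (q := fun θ => q θ ω) (fun p _ θ _ _ => by simp) (by simp) (by simp)
    (monotoneOn_of_subgradient (hB.subgradient hω)) (fun y hy => hB.q_mem y hy ω hω) hM0 hM ?_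
  intro θ hθ
  have e := integral_subgradient (hB.subgradient hω) h0 hθ
  have hp := hB.participation 0 h0 ω hω
  simp only [one_mul]
  rw [e, sellerPayoff_eq]
  simp only [buyerUtility] at *
  linarith

end Mechanism

/-! ### Prices that depend on the cost -/

/-- Expected revenue net of cost from offering the price `p` at the cost `ω`. -/
noncomputable def revenue (μ : Measure ℝ) (p ω : ℝ) : ℝ := demand μ p * (p - ω)

theorem continuous_revenue [FullLaw μ] : Continuous fun z : ℝ × ℝ => revenue μ z.1 z.2 :=
  (continuous_demand.comp continuous_fst).mul (continuous_fst.sub continuous_snd)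

theorem abs_revenue_le [FullLaw μ] {p ω : ℝ} (hp : p ∈ Icc (0 : ℝ) 1) (hω : ω ∈ Icc (0 : ℝ) 1) :
    |revenue μ p ω| ≤ 1 := by
  rw [revenue, abs_mul, abs_of_nonneg (demand_nonneg p)]
  refine mul_le_one₀ (demand_le_one p) (abs_nonneg _) ?_
  rw [abs_le]
  constructor <;> linarith [hp.1, hp.2, hω.1, hω.2]

/-- The allocation of the mechanism that offers the buyer the price `π ω` at the cost `ω`. -/
noncomputable def priceAllocation (π : ℝ → ℝ) (θ ω : ℝ) : ℝ := if π ω ≤ θ then 1 else 0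

/-- The transfers of the mechanism that offers the buyer the price `π ω` at the cost `ω`. -/
noncomputable def priceTransfer (π : ℝ → ℝ) (θ ω : ℝ) : ℝ := if π ω ≤ θ then π ω else 0

theorem buyerFeasible_price {π : ℝ → ℝ} (hπ : Measurable π) :
    BuyerFeasible (priceAllocation π) (priceTransfer π) where
  measurable_q := Measurable.ite (measurableSet_le (hπ.comp measurable_snd) measurable_fst)
    measurable_const measurable_const
  measurable_t := Measurable.ite (measurableSet_le (hπ.comp measurable_snd) measurable_fst)
    (hπ.comp measurable_snd) measurable_const
  q_mem θ _ ω _ := by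
    unfold priceAllocation
    split_ifs <;> simp
  participation θ _ ω _ := by
    unfold priceAllocation priceTransfer
    split_ifs with h
    · linarith
    · simp
  truthful θ _ θ' _ ω _ := by
    unfold priceAllocation priceTransfer
    split_ifs with h h' h' <;> linarith

theorem sellerPayoff_price {π : ℝ → ℝ} (θ ω : ℝ) :
    sellerPayoff (priceAllocation π) (priceTransfer π) (θ, ω)
      = (Ici (π ω)).indicator (fun _ => π ω - ω) θ := by
  unfold sellerPayoff priceAllocation priceTransfer
  by_cases h : π ω ≤ θ <;> simp [h]

theorem integrable_sellerPayoff_price [FullLaw μ] [FullLaw ν] {π : ℝ → ℝ} (hπ : Measurable π)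
    (hπ02 : ∀ ω, π ω ∈ Icc (0 : ℝ) 2) :
    Integrable (sellerPayoff (priceAllocation π) (priceTransfer π)) (μ.prod ν) := by
  have hB := buyerFeasible_price hπ
  refine Integrable.of_bound (C := 2)
    (hB.measurable_t.sub (measurable_snd.mul hB.measurable_q)).aestronglyMeasurable ?_
  filter_upwards [Measure.quasiMeasurePreserving_snd.ae (FullLaw.ae_mem (μ := ν))] with z hz
  rw [Real.norm_eq_abs, sellerPayoff_price]
  by_cases h : z.1 ∈ Ici (π z.2)
  · rw [indicator_of_mem h, abs_le]
    constructor <;> linarith [(hπ02 z.2).1, (hπ02 z.2).2, hz.1, hz.2]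
  · simp [indicator_of_notMem h]

theorem integral_sellerPayoff_price [FullLaw μ] [FullLaw ν] {π : ℝ → ℝ} (hπ : Measurable π)
    (hπ02 : ∀ ω, π ω ∈ Icc (0 : ℝ) 2) :
    ∫ z, sellerPayoff (priceAllocation π) (priceTransfer π) z ∂(μ.prod ν)
      = ∫ ω, revenue μ (π ω) ω ∂ν := by
  rw [integral_prod_symm _ (integrable_sellerPayoff_price hπ hπ02)]
  refine integral_congr_ae (Eventually.of_forall fun ω => ?_)
  simp only [sellerPayoff_price]
  rw [integral_indicator_const _ measurableSet_Ici, smul_eq_mul, revenue, demand]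

/-! ### Optimal prices against a truncated law -/

/-- Profit of the price `p ≤ x` at the cost `ω` when the types above `x` have left; it is not
normalized by the probability of the remaining types. -/
noncomputable def residualRevenue (μ : Measure ℝ) (x ω p : ℝ) : ℝ :=
  (p - ω) * (demand μ p - demand μ x)

/-- The prices in `[0, x]` that are optimal at the cost `ω` against the types below `x`. -/
def optimalPrices (μ : Measure ℝ) (x ω : ℝ) : Set ℝ :=
  {p | p ∈ Icc 0 x ∧ ∀ p' ∈ Icc 0 x, residualRevenue μ x ω p' ≤ residualRevenue μ x ω p}

/-- The largest optimal price in `[0, x]`. -/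
noncomputable def optimalPrice (μ : Measure ℝ) (x ω : ℝ) : ℝ := sSup (optimalPrices μ x ω)

theorem continuous_residualRevenue [FullLaw μ] :
    Continuous fun z : ℝ × ℝ × ℝ => residualRevenue μ z.1 z.2.1 z.2.2 := by
  unfold residualRevenue
  have := continuous_demand (μ := μ)
  fun_prop

theorem optimalPrice_mem [FullLaw μ] {x : ℝ} (hx : 0 ≤ x) (ω : ℝ) :
    optimalPrice μ x ω ∈ optimalPrices μ x ω := by
  have hc : Continuous (residualRevenue μ x ω) :=
    continuous_residualRevenue.comp (by fun_prop : Continuous fun p : ℝ => (x, ω, p))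
  obtain ⟨p, hp, hmax⟩ := isCompact_Icc.exists_isMaxOn (nonempty_Icc.2 hx) hc.continuousOn
  have hcl : IsClosed (optimalPrices μ x ω) := by
    have : optimalPrices μ x ω = Icc 0 x ∩
        ⋂ p' ∈ Icc 0 x, {p | residualRevenue μ x ω p' ≤ residualRevenue μ x ω p} := by
      ext p
      simp [optimalPrices]
    rw [this]
    exact isClosed_Icc.inter (isClosed_biInter fun p' _ => isClosed_le continuous_const hc)
  exact (isCompact_Icc.of_isClosed_subset hcl fun p hp => hp.1).sSup_mem ⟨p, hp, hmax⟩

theorem optimalPrice_mem_Icc [FullLaw μ] {x : ℝ} (hx : x ∈ Icc (0 : ℝ) 1) (ω : ℝ) :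
    optimalPrice μ x ω ∈ Icc (0 : ℝ) 1 :=
  ⟨(optimalPrice_mem hx.1 ω).1.1, (optimalPrice_mem hx.1 ω).1.2.trans hx.2⟩

/-- Every price that is optimal at a higher cost is at least as high. -/
theorem optimalPrices_le [FullLaw μ] {x ω ω' p p' : ℝ} (hx1 : x ≤ 1) (hω : ω < ω')
    (hp : p ∈ optimalPrices μ x ω) (hp' : p' ∈ optimalPrices μ x ω') : p ≤ p' := by
  by_contra! h
  have h1 := hp.2 p' hp'.1
  have h2 := hp'.2 p hp.1
  have h3 := demand_strictAnti (μ := μ) hp'.1.1 h (hp.1.2.trans hx1)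
  simp only [residualRevenue] at h1 h2
  nlinarith [mul_pos (sub_pos.2 hω) (sub_pos.2 h3)]

theorem optimalPrice_mono [FullLaw μ] {x : ℝ} (hx : x ∈ Icc (0 : ℝ) 1) :
    Monotone (optimalPrice μ x) := by
  intro ω ω' h
  rcases h.eq_or_lt with rfl | h
  · exact le_rfl
  · exact optimalPrices_le hx.2 h (optimalPrice_mem hx.1 ω) (optimalPrice_mem hx.1 ω')

/-- At almost every cost the optimal price is unique: two optimal prices force a jump of the
monotone function `optimalPrice`, which has at most countably many. -/
theorem ae_optimalPrice_unique [FullLaw μ] [FullLaw ν] {x : ℝ} (hx : x ∈ Icc (0 : ℝ) 1) :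
    ∀ᵐ ω ∂ν, ∀ p ∈ optimalPrices μ x ω, p = optimalPrice μ x ω := by
  filter_upwards [(optimalPrice_mono (μ := μ) hx).countable_not_continuousAt.ae_notMem ν]
    with ω hω p hp
  have hc : ContinuousAt (optimalPrice μ x) ω := by simpa using hω
  refine le_antisymm ?_ ?_
  · refine ge_of_tendsto (hc.tendsto.mono_left (nhdsWithin_le_nhds (s := Ioi ω))) ?_
    filter_upwards [self_mem_nhdsWithin] with ω' hω'
    exact optimalPrices_le hx.2 hω' hp (optimalPrice_mem hx.1 ω')
  · refine le_of_tendsto (hc.tendsto.mono_left (nhdsWithin_le_nhds (s := Iio ω))) ?_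
    filter_upwards [self_mem_nhdsWithin] with ω' hω'
    exact optimalPrices_le hx.2 hω' (optimalPrice_mem hx.1 ω') hp

/-- Where the optimal price is unique, it depends continuously on the truncation. -/
theorem continuousWithinAt_optimalPrice [FullLaw μ] {x ω : ℝ}
    (hu : ∀ p ∈ optimalPrices μ x ω, p = optimalPrice μ x ω) :
    ContinuousWithinAt (fun y => optimalPrice μ y ω) (Icc 0 1) x := by
  refine (isCompact_Icc (a := (0 : ℝ)) (b := 1)).tendsto_nhds_of_unique_mapClusterPt ?_ ?_
  · filter_upwards [self_mem_nhdsWithin] with y hy using optimalPrice_mem_Icc hy ω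
  · intro a ha hcl
    obtain ⟨W, hW, hWa⟩ := mapClusterPt_iff_ultrafilter.1 hcl
    have hWx : Tendsto (fun y : ℝ => y) W (𝓝 x) := hW.trans nhdsWithin_le_nhds
    have hWI : ∀ᶠ y in (W : Filter ℝ), y ∈ Icc (0 : ℝ) 1 := hW self_mem_nhdsWithin
    refine hu a ⟨⟨ha.1, le_of_tendsto_of_tendsto hWa hWx ?_⟩, fun p' hp' => ?_⟩
    · filter_upwards [hWI] with y hy using (optimalPrice_mem hy.1 ω).1.2
    · have l1 : Tendsto (fun y => residualRevenue μ y ω (min p' y)) W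
          (𝓝 (residualRevenue μ x ω (min p' x))) :=
        ((continuous_residualRevenue (μ := μ)).tendsto (x, ω, min p' x)).comp
          (hWx.prodMk_nhds (tendsto_const_nhds.prodMk_nhds (tendsto_const_nhds.min hWx)))
      have l2 : Tendsto (fun y => residualRevenue μ y ω (optimalPrice μ y ω)) W
          (𝓝 (residualRevenue μ x ω a)) :=
        ((continuous_residualRevenue (μ := μ)).tendsto (x, ω, a)).comp
          (hWx.prodMk_nhds (tendsto_const_nhds.prodMk_nhds hWa))
      rw [min_eq_left hp'.2] at l1
      refine le_of_tendsto_of_tendsto l1 l2 ?_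
      filter_upwards [hWI] with y hy
      exact (optimalPrice_mem hy.1 ω).2 _ ⟨le_min hp'.1 hy.1, min_le_right _ _⟩

/-- The revenue, over all types, of the prices that are optimal against the types below `x`. -/
noncomputable def lateRevenue (μ ν : Measure ℝ) (x : ℝ) : ℝ :=
  ∫ ω, revenue μ (optimalPrice μ x ω) ω ∂ν

theorem measurable_optimalPrice [FullLaw μ] {x : ℝ} (hx : x ∈ Icc (0 : ℝ) 1) :
    Measurable (optimalPrice μ x) := (optimalPrice_mono hx).measurable

theorem measurable_revenue_optimalPrice [FullLaw μ] {x : ℝ} (hx : x ∈ Icc (0 : ℝ) 1) :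
    Measurable fun ω => revenue μ (optimalPrice μ x ω) ω :=
  continuous_revenue.measurable.comp ((measurable_optimalPrice hx).prodMk measurable_id)

theorem integrable_revenue_optimalPrice [FullLaw μ] [FullLaw ν] {x : ℝ}
    (hx : x ∈ Icc (0 : ℝ) 1) : Integrable (fun ω => revenue μ (optimalPrice μ x ω) ω) ν :=
  integrable_of_bdd (measurable_revenue_optimalPrice hx).aestronglyMeasurable fun ω hω =>
    abs_revenue_le (optimalPrice_mem_Icc hx ω) hω

theorem integrable_optimalPrice [FullLaw μ] [FullLaw ν] {x : ℝ} (hx : x ∈ Icc (0 : ℝ) 1) :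
    Integrable (optimalPrice μ x) ν :=
  integrable_of_bdd (C := 1) (measurable_optimalPrice hx).aestronglyMeasurable fun ω _ => by
    rw [abs_of_nonneg (optimalPrice_mem_Icc hx ω).1]
    exact (optimalPrice_mem_Icc hx ω).2

theorem continuousOn_lateRevenue [FullLaw μ] [FullLaw ν] :
    ContinuousOn (lateRevenue μ ν) (Icc 0 1) := by
  intro x hx
  refine continuousWithinAt_of_dominated (bound := fun _ => 1) ?_ ?_ (integrable_const _) ?_
  · filter_upwards [self_mem_nhdsWithin] with y hy
    exact (measurable_revenue_optimalPrice hy).aestronglyMeasurable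
  · filter_upwards [self_mem_nhdsWithin] with y hy
    filter_upwards [FullLaw.ae_mem (μ := ν)] with ω hω
    exact abs_revenue_le (optimalPrice_mem_Icc hy ω) hω
  · filter_upwards [ae_optimalPrice_unique (μ := μ) (ν := ν) hx] with ω hω
    exact (continuous_revenue (μ := μ)).continuousAt.comp_continuousWithinAt
      (f := fun y => (optimalPrice μ y ω, ω))
      ((continuousWithinAt_optimalPrice hω).prodMk continuousWithinAt_const)

theorem continuousOn_integral_optimalPrice [FullLaw μ] [FullLaw ν] :
    ContinuousOn (fun x => ∫ ω, optimalPrice μ x ω ∂ν) (Icc 0 1) := by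
  intro x hx
  refine continuousWithinAt_of_dominated (bound := fun _ => 1) ?_ ?_ (integrable_const _) ?_
  · filter_upwards [self_mem_nhdsWithin] with y hy
    exact (measurable_optimalPrice hy).aestronglyMeasurable
  · filter_upwards [self_mem_nhdsWithin] with y hy
    filter_upwards with ω
    rw [Real.norm_eq_abs, abs_of_nonneg (optimalPrice_mem_Icc hy ω).1]
    exact (optimalPrice_mem_Icc hy ω).2
  · filter_upwards [ae_optimalPrice_unique (μ := μ) (ν := ν) hx] with ω hω
    exact continuousWithinAt_optimalPrice hω

theorem residualRevenue_one [FullLaw μ] (ω p : ℝ) :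
    residualRevenue μ 1 ω p = revenue μ p ω := by
  rw [residualRevenue, demand_of_one_le le_rfl, revenue]
  ring

theorem revenue_le_optimal [FullLaw μ] (ω : ℝ) {p : ℝ} (hp : p ∈ Icc (0 : ℝ) 1) :
    revenue μ p ω ≤ revenue μ (optimalPrice μ 1 ω) ω := by
  have := (optimalPrice_mem (μ := μ) zero_le_one ω).2 p hp
  rwa [residualRevenue_one, residualRevenue_one] at this

theorem revenue_optimal_nonneg [FullLaw μ] (ω : ℝ) :
    0 ≤ revenue μ (optimalPrice μ 1 ω) ω := by
  have := revenue_le_optimal (μ := μ) ω (p := 1) (by simp)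
  rwa [revenue, demand_of_one_le le_rfl, zero_mul] at this

theorem revenue_optimal_pos [FullLaw μ] {ω : ℝ} (hω : ω ∈ Ico (0 : ℝ) 1) :
    0 < revenue μ (optimalPrice μ 1 ω) ω := by
  have h := revenue_le_optimal (μ := μ) ω (p := (ω + 1) / 2)
    ⟨by linarith [hω.1], by linarith [hω.2]⟩
  refine lt_of_lt_of_le (mul_pos (demand_pos ?_) ?_) h <;> linarith [hω.2]

theorem le_optimalPrice_one [FullLaw μ] {ω : ℝ} (hω : ω ≤ 1) : ω ≤ optimalPrice μ 1 ω := by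
  by_contra! h
  have h1 := revenue_optimal_nonneg (μ := μ) ω
  have h2 := demand_pos (μ := μ) (h.trans_le hω)
  rw [revenue] at h1
  nlinarith

theorem lateRevenue_one_pos [FullLaw μ] [FullLaw ν] : 0 < lateRevenue μ ν 1 := by
  rw [lateRevenue, integral_pos_iff_support_of_nonneg (fun ω => revenue_optimal_nonneg ω)
    (integrable_revenue_optimalPrice (by simp))]
  exact (FullLaw.pos (μ := ν) 0 1 le_rfl one_pos le_rfl).trans_le
    (measure_mono fun ω hω => (revenue_optimal_pos ⟨hω.1.le, hω.2⟩).ne')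

/-- Truncating the law at `x` lowers the late revenue by at most the probability `demand μ x` of the
excluded types times the mean change of the price. -/
theorem lateRevenue_one_sub_le [FullLaw μ] [FullLaw ν] {x : ℝ} (hx : x ∈ Icc (0 : ℝ) 1) :
    lateRevenue μ ν 1 - lateRevenue μ ν x
      ≤ demand μ x * (∫ ω, optimalPrice μ 1 ω ∂ν - ∫ ω, optimalPrice μ x ω ∂ν) := by
  have h1 : (1 : ℝ) ∈ Icc (0 : ℝ) 1 := by simp
  rw [lateRevenue, lateRevenue, ← integral_sub (integrable_revenue_optimalPrice h1)
    (integrable_revenue_optimalPrice hx), ← integral_sub (integrable_optimalPrice h1)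
    (integrable_optimalPrice hx), ← integral_const_mul]
  refine integral_mono_ae ((integrable_revenue_optimalPrice h1).sub
    (integrable_revenue_optimalPrice hx)) (((integrable_optimalPrice h1).sub
    (integrable_optimalPrice hx)).const_mul _) ?_
  filter_upwards [FullLaw.ae_mem (μ := ν)] with ω hω
  have hm := (optimalPrice_mem (μ := μ) hx.1 ω).2
  have key : residualRevenue μ x ω (optimalPrice μ 1 ω)
      ≤ residualRevenue μ x ω (optimalPrice μ x ω) := by
    rcases le_total (optimalPrice μ 1 ω) x with h | h
    · exact hm _ ⟨(optimalPrice_mem_Icc h1 ω).1, h⟩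
    · refine le_trans ?_ (hm x ⟨hx.1, le_rfl⟩)
      have e : residualRevenue μ x ω x = 0 := by simp [residualRevenue]
      rw [e]
      exact mul_nonpos_of_nonneg_of_nonpos (sub_nonneg.2 (le_optimalPrice_one hω.2))
        (sub_nonpos.2 (demand_antitone h))
  simp only [residualRevenue] at key
  simp only [revenue]
  linarith

/-! ### Equilibria of the dynamic mechanism -/

/-- The profit of the dynamic mechanism with threshold `x`, once the time 0 price has been
eliminated through the indifference of the threshold type: a mixture of the ex-ante posted price `x`
and of the late revenue. -/
noncomputable def dynamicProfit (μ ν : Measure ℝ) (δ x : ℝ) : ℝ :=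
  (1 - δ) * revenue μ x (∫ ω, ω ∂ν) + δ * lateRevenue μ ν x

theorem measureReal_Ico_min [FullLaw μ] (p x : ℝ) :
    μ.real (Ico p x) = demand μ (min p x) - demand μ x := by
  rcases le_total p x with h | h
  · rw [min_eq_left h, measureReal_Ico_eq h]
  · rw [min_eq_right h, Ico_eq_empty (not_lt.2 h), measureReal_empty, sub_self]

theorem cond_Iio_real_Ici [FullLaw μ] (x p : ℝ) :
    (μ[|Iio x]).real (Ici p) = (1 - demand μ x)⁻¹ * (demand μ (min p x) - demand μ x) := by
  have h1 : μ.real (Iio x) = 1 - demand μ x := by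
    rw [← compl_Ici, probReal_compl_eq_one_sub measurableSet_Ici, demand]
  have h2 : Iio x ∩ Ici p = Ico p x := by
    ext y
    simp [and_comm]
  rw [measureReal_def, cond_apply measurableSet_Iio, h2, ENNReal.toReal_mul, ENNReal.toReal_inv,
    ← measureReal_def, ← measureReal_def, h1, measureReal_Ico_min]

/-- A price, possibly outside `[0, x]`, is optimal against the types below `x` if and only if its
truncation to `(-∞, x]` is an optimal price in `[0, x]`. -/
theorem optimal_iff_min_mem [FullLaw μ] {x ω p : ℝ} (hx : x ∈ Ioc (0 : ℝ) 1) :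
    (∀ p', (p' - ω) * (μ[|Iio x]).real (Ici p') ≤ (p - ω) * (μ[|Iio x]).real (Ici p)) ↔
      min p x ∈ optimalPrices μ x ω := by
  have hk : 0 < 1 - demand μ x := sub_pos.2 (demand_lt_one hx.1)
  have hW : ∀ p', (p' - ω) * (μ[|Iio x]).real (Ici p')
      = (1 - demand μ x)⁻¹ * residualRevenue μ x ω (min p' x) := by
    intro p'
    rw [cond_Iio_real_Ici, residualRevenue]
    rcases le_total p' x with h | h
    · rw [min_eq_left h]
      ring
    · rw [min_eq_right h]
      ring
  have hneg : ∀ p', p' < 0 → residualRevenue μ x ω p' < residualRevenue μ x ω 0 := by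
    intro p' h
    rw [residualRevenue, residualRevenue, demand_of_nonpos h.le, demand_of_nonpos le_rfl]
    exact mul_lt_mul_of_pos_right (by linarith) hk
  simp_rw [hW, mul_le_mul_iff_right₀ (inv_pos.2 hk)]
  constructor
  · intro h
    refine ⟨⟨le_min ?_ hx.1.le, min_le_right _ _⟩, fun p' hp' => ?_⟩
    · by_contra! hp
      have h0 := h 0
      rw [min_eq_left hx.1.le, min_eq_left (hp.le.trans hx.1.le)] at h0
      exact (hneg p hp).not_ge h0
    · have := h p'
      rwa [min_eq_left hp'.2] at this
  · intro h p'
    rcases lt_or_ge p' 0 with hp' | hp'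
    · rw [min_eq_left (hp'.le.trans hx.1.le)]
      exact (hneg p' hp').le.trans (h.2 0 ⟨le_rfl, hx.1.le⟩)
    · exact h.2 _ ⟨le_min hp' hx.1.le, min_le_right _ _⟩

/-- The decomposition of the late revenue into what the types below `x` pay and what the types above
`x` would pay. -/
theorem integral_residualRevenue [FullLaw μ] [FullLaw ν] {x : ℝ} (hx : x ∈ Icc (0 : ℝ) 1) :
    ∫ ω, residualRevenue μ x ω (optimalPrice μ x ω) ∂ν
      = lateRevenue μ ν x - demand μ x * (∫ ω, optimalPrice μ x ω ∂ν - ∫ ω, ω ∂ν) := by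
  have hi : Integrable (fun ω : ℝ => ω) ν := integrable_of_continuous continuous_id
  have hp := integrable_optimalPrice (μ := μ) (ν := ν) hx
  have hd : Integrable (fun ω => demand μ x * (optimalPrice μ x ω - ω)) ν :=
    (hp.sub hi).const_mul _
  rw [lateRevenue, ← integral_sub hp hi, ← integral_const_mul,
    ← integral_sub (integrable_revenue_optimalPrice hx) hd]
  refine integral_congr_ae (Eventually.of_forall fun ω => ?_)
  simp only [residualRevenue, revenue]
  ring

section Equilibrium

variable {f g : ℝ → ℝ} {δ p₀ x : ℝ} {p₁ : ℝ → ℝ} {β : Measure ℝ}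

/-- In an equilibrium the threshold type, if interior, is indifferent between the two dates. -/
theorem IsThresholdPBE.indifferent [FullLaw (law f)] [FullLaw (law g)]
    (h : IsThresholdPBE f g δ p₀ x p₁ β) (hδ : 0 ≤ δ) (hx0 : 0 < x) (hx1 : x < 1)
    (hp₁ : ∀ ω ∈ Icc (0 : ℝ) 1, 0 ≤ p₁ ω) :
    p₀ = x - δ * ∫ ω, max (x - p₁ ω) 0 ∂(law g) := by
  have hint : ∀ θ : ℝ, 0 ≤ θ → Integrable (fun ω => max (θ - p₁ ω) 0) (law g) := by
    intro θ hθ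
    refine integrable_of_bdd (C := θ)
      ((measurable_const.sub h.measurable_price).max measurable_const).aestronglyMeasurable ?_
    intro ω hω
    rw [abs_of_nonneg (le_max_right _ _)]
    exact max_le (by linarith [hp₁ ω hω]) hθ
  have hmono : ∀ θ θ' : ℝ, 0 ≤ θ → θ ≤ θ' →
      δ * ∫ ω, max (θ - p₁ ω) 0 ∂(law g) ≤ δ * ∫ ω, max (θ' - p₁ ω) 0 ∂(law g) := by
    intro θ θ' hθ hθθ'
    refine mul_le_mul_of_nonneg_left (integral_mono (hint θ hθ) (hint θ' (hθ.trans hθθ')) ?_) hδ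
    intro ω
    exact max_le_max_right _ (by linarith)
  refine le_antisymm ?_ ?_
  · refine ge_of_tendsto (x := 𝓝[>] x)
      (f := fun θ => θ - δ * ∫ ω, max (x - p₁ ω) 0 ∂(law g)) ?_ ?_
    · exact ((continuous_id.sub continuous_const).tendsto x).mono_left nhdsWithin_le_nhds
    · filter_upwards [Ioo_mem_nhdsGT hx1] with θ hθ
      have := h.accept_optimal θ ⟨(hx0.trans hθ.1).le, hθ.2.le⟩ hθ.1
      linarith [hmono x θ hx0.le hθ.1.le]
  · refine le_of_tendsto (x := 𝓝[<] x)
      (f := fun θ => θ - δ * ∫ ω, max (x - p₁ ω) 0 ∂(law g)) ?_ ?_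
    · exact ((continuous_id.sub continuous_const).tendsto x).mono_left nhdsWithin_le_nhds
    · filter_upwards [Ioo_mem_nhdsLT hx0] with θ hθ
      have := h.reject_optimal θ ⟨hθ.1.le, hθ.2.le.trans hx1.le⟩ hθ.2
      linarith [hmono θ x hθ.1.le hθ.2.le]

/-- If the truncated late prices are optimal and the threshold type is indifferent (unless nobody
accepts at time 0), then the profit is `dynamicProfit`. -/
theorem profitD_eq_dynamicProfit [FullLaw (law f)] [FullLaw (law g)] (hx : x ∈ Ioc (0 : ℝ) 1)
    (hp₁ : ∀ ω ∈ Icc (0 : ℝ) 1, min (p₁ ω) x ∈ optimalPrices (law f) x ω)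
    (hp₀ : x < 1 → p₀ = x - δ * ∫ ω, max (x - p₁ ω) 0 ∂(law g)) :
    profitD f g δ p₀ x p₁ = dynamicProfit (law f) (law g) δ x := by
  have hxI : x ∈ Icc (0 : ℝ) 1 := ⟨hx.1.le, hx.2⟩
  have hae : ∀ᵐ ω ∂(law g), min (p₁ ω) x = optimalPrice (law f) x ω := by
    filter_upwards [FullLaw.ae_mem (μ := law g),
      ae_optimalPrice_unique (μ := law f) (ν := law g) hxI] with ω hω hu
    exact hu _ (hp₁ ω hω)
  have e1 : ∫ ω, max (x - p₁ ω) 0 ∂(law g) = x - ∫ ω, optimalPrice (law f) x ω ∂(law g) := by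
    have : ∫ ω, (x - optimalPrice (law f) x ω) ∂(law g)
        = x - ∫ ω, optimalPrice (law f) x ω ∂(law g) := by
      rw [integral_sub (integrable_const _) (integrable_optimalPrice hxI)]
      simp
    rw [← this]
    refine integral_congr_ae (hae.mono fun ω hω => ?_)
    simp only
    rw [← hω]
    rcases le_total (p₁ ω) x with h | h
    · rw [min_eq_left h, max_eq_left (sub_nonneg.2 h)]
    · rw [min_eq_right h, max_eq_right (sub_nonpos.2 h), sub_self]
  have e2 : ∫ ω, (p₁ ω - ω) * (law f).real (Ico (p₁ ω) x) ∂(law g)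
      = ∫ ω, residualRevenue (law f) x ω (optimalPrice (law f) x ω) ∂(law g) := by
    refine integral_congr_ae (hae.mono fun ω hω => ?_)
    simp only
    rw [← hω, measureReal_Ico_min, residualRevenue]
    rcases le_total (p₁ ω) x with h | h
    · rw [min_eq_left h]
    · rw [min_eq_right h, sub_self, mul_zero, mul_zero]
  have e3 : demand (law f) x * p₀
      = demand (law f) x * (x - δ * (x - ∫ ω, optimalPrice (law f) x ω ∂(law g))) := by
    rcases hx.2.eq_or_lt with h | h
    · rw [demand_of_one_le h.ge, zero_mul, zero_mul]
    · rw [hp₀ h, e1]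
  rw [profitD, e2, integral_residualRevenue hxI, dynamicProfit, revenue, meanCost]
  change demand (law f) x * _ + _ = _
  linear_combination e3

theorem IsThresholdPBE.profit_eq [FullLaw (law f)] [FullLaw (law g)]
    (h : IsThresholdPBE f g δ p₀ x p₁ β) (hδ : 0 ≤ δ) (hx : 0 < x) :
    profitD f g δ p₀ x p₁ = dynamicProfit (law f) (law g) δ x := by
  have hx' : x ∈ Ioc (0 : ℝ) 1 := ⟨hx, h.threshold_mem.2⟩
  have hne : law f (Iio x) ≠ 0 :=
    ((FullLaw.pos (μ := law f) 0 x le_rfl hx hx'.2).trans_le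
      (measure_mono Ioo_subset_Iio_self)).ne'
  have hp₁ : ∀ ω ∈ Icc (0 : ℝ) 1, min (p₁ ω) x ∈ optimalPrices (law f) x ω := by
    intro ω hω
    have := h.price_optimal ω hω
    rw [h.belief_bayes hne] at this
    exact (optimal_iff_min_mem hx').1 this
  exact profitD_eq_dynamicProfit hx' hp₁ fun hx1 => h.indifferent hδ hx hx1 fun ω hω =>
    (hp₁ ω hω).1.1.trans (min_le_left _ _)

/-- If everybody is to accept at time 0, the object must be given away. -/
theorem IsThresholdPBE.profit_nonpos [FullLaw (law f)] [FullLaw (law g)]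
    (h : IsThresholdPBE f g δ p₀ 0 p₁ β) (hδ : 0 ≤ δ) : profitD f g δ p₀ 0 p₁ ≤ 0 := by
  have hp₀ : p₀ ≤ 0 := by
    refine ge_of_tendsto (x := 𝓝[>] (0 : ℝ)) (f := fun θ => θ) ?_ ?_
    · exact (continuous_id.tendsto 0).mono_left nhdsWithin_le_nhds
    · filter_upwards [Ioo_mem_nhdsGT one_pos] with θ hθ
      have h1 := h.accept_optimal θ ⟨hθ.1.le, hθ.2.le⟩ hθ.1
      have h2 : 0 ≤ δ * ∫ ω, max (θ - p₁ ω) 0 ∂(law g) :=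
        mul_nonneg hδ (integral_nonneg fun ω => le_max_right _ _)
      linarith
  have e : ∀ ω, (p₁ ω - ω) * (law f).real (Ico (p₁ ω) 0) = 0 := by
    intro ω
    rw [measureReal_Ico_min, demand_of_nonpos (min_le_right _ _), demand_of_nonpos le_rfl]
    ring
  have hd : (law f).real (Ici 0) = 1 := demand_of_nonpos le_rfl
  simp only [profitD, e, hd, integral_zero, meanCost]
  linarith [(mean_mem_Ioo (μ := law g)).1]

/-- Every threshold `x > 0` is supported by an equilibrium. -/
theorem dynamicProfit_mem_achievableD [FullLaw (law f)] [FullLaw (law g)] (hδ0 : 0 ≤ δ)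
    (hδ1 : δ ≤ 1) (hx : x ∈ Ioc (0 : ℝ) 1) :
    dynamicProfit (law f) (law g) δ x ∈ achievableD f g δ := by
  have hxI : x ∈ Icc (0 : ℝ) 1 := ⟨hx.1.le, hx.2⟩
  have hne : law f (Iio x) ≠ 0 :=
    ((FullLaw.pos (μ := law f) 0 x le_rfl hx.1 hx.2).trans_le
      (measure_mono Ioo_subset_Iio_self)).ne'
  set π := optimalPrice (law f) x with hπ
  have hmin : ∀ ω, min (π ω) x = π ω := fun ω => min_eq_left (optimalPrice_mem hxI.1 ω).1.2
  have hint : ∀ θ : ℝ, Integrable (fun ω => max (θ - π ω) 0) (law g) := fun θ =>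
    ((integrable_const θ).sub (integrable_optimalPrice hxI)).pos_part
  -- Waiting is worth at most one unit more when the value is one unit higher.
  have hlip : ∀ θ θ' : ℝ, θ ≤ θ' → ∫ ω, max (θ' - π ω) 0 ∂(law g)
      ≤ ∫ ω, max (θ - π ω) 0 ∂(law g) + (θ' - θ) := by
    intro θ θ' h
    have e : ∫ ω, max (θ - π ω) 0 ∂(law g) + (θ' - θ)
        = ∫ ω, (max (θ - π ω) 0 + (θ' - θ)) ∂(law g) := by
      rw [integral_add (hint θ) (integrable_const _)]
      simp
    rw [e]
    refine integral_mono (hint θ') ((hint θ).add (integrable_const _)) fun ω => max_le ?_ ?_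
    · linarith [le_max_left (θ - π ω) 0]
    · exact add_nonneg (le_max_right _ _) (sub_nonneg.2 h)
  refine ⟨x - δ * ∫ ω, max (x - π ω) 0 ∂(law g), x, π, (law f)[|Iio x], ?_, ?_⟩
  · refine ⟨hxI, measurable_optimalPrice hxI, cond_isProbabilityMeasure hne, ?_, fun _ => rfl,
      fun ω hω => ?_, fun θ _ hθ => ?_, fun θ _ hθ => ?_⟩
    · exact cond_absolutelyContinuous (FullLaw.ae_mem (μ := law f))
    · refine (optimal_iff_min_mem hx).2 ?_
      rw [hmin]
      exact optimalPrice_mem hxI.1 ω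
    · have h1 := mul_le_mul_of_nonneg_left (hlip x θ hθ.le) hδ0
      nlinarith
    · have h1 := mul_le_mul_of_nonneg_left (hlip θ x hθ.le) hδ0
      nlinarith
  · refine (profitD_eq_dynamicProfit hx (fun ω _ => ?_) fun _ => rfl).symm
    rw [hmin]
    exact optimalPrice_mem hxI.1 ω

end Equilibrium

/-! ### The best dynamic mechanism -/

theorem continuousOn_dynamicProfit [FullLaw μ] [FullLaw ν] (δ : ℝ) :
    ContinuousOn (dynamicProfit μ ν δ) (Icc 0 1) := by
  have h1 : Continuous fun x => revenue μ x (∫ ω, ω ∂ν) :=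
    continuous_revenue.comp (by fun_prop : Continuous fun x : ℝ => (x, ∫ ω, ω ∂ν))
  exact (continuousOn_const.mul h1.continuousOn).add
    (continuousOn_const.mul continuousOn_lateRevenue)

/-- The largest value of `dynamicProfit` over all thresholds. -/
noncomputable def bestDynamic (μ ν : Measure ℝ) (δ : ℝ) : ℝ :=
  sSup (dynamicProfit μ ν δ '' Icc 0 1)

theorem isGreatest_bestDynamic [FullLaw μ] [FullLaw ν] (δ : ℝ) :
    IsGreatest (dynamicProfit μ ν δ '' Icc 0 1) (bestDynamic μ ν δ) :=
  (isCompact_Icc.image_of_continuousOn (continuousOn_dynamicProfit δ)).isGreatest_sSup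
    ((nonempty_Icc.2 zero_le_one).image _)

theorem dynamicProfit_le_best [FullLaw μ] [FullLaw ν] (δ : ℝ) {x : ℝ} (hx : x ∈ Icc (0 : ℝ) 1) :
    dynamicProfit μ ν δ x ≤ bestDynamic μ ν δ :=
  (isGreatest_bestDynamic δ).2 (mem_image_of_mem _ hx)

/-- A maximum of affine functions of the discount factor is convex. -/
theorem convexOn_bestDynamic [FullLaw μ] [FullLaw ν] : ConvexOn ℝ univ (bestDynamic μ ν) := by
  refine ⟨convex_univ, fun δ _ δ' _ a b ha hb hab => ?_⟩
  obtain ⟨x, hx, he⟩ := (isGreatest_bestDynamic (μ := μ) (ν := ν) (a • δ + b • δ')).1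
  rw [← he]
  have h1 := mul_le_mul_of_nonneg_left (dynamicProfit_le_best (μ := μ) (ν := ν) δ hx) ha
  have h2 := mul_le_mul_of_nonneg_left (dynamicProfit_le_best (μ := μ) (ν := ν) δ' hx) hb
  simp only [smul_eq_mul, dynamicProfit] at *
  have e : 1 - (a * δ + b * δ') = a * (1 - δ) + b * (1 - δ') := by linear_combination -hab
  rw [e]
  linarith

/-- The dynamic mechanism beats the ex-post optimum: near the threshold `x = 1` the gain
`(1 - δ) (x - E ω)` from serving a type above `x` earlier dominates the loss from lower late
prices, which vanishes as `x → 1`. -/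
theorem late_lt_bestDynamic [FullLaw μ] [FullLaw ν] {δ : ℝ} (hδ0 : 0 ≤ δ) (hδ1 : δ < 1) :
    δ * lateRevenue μ ν 1 < bestDynamic μ ν δ := by
  set c := ∫ ω, ω ∂ν with hc
  have hc1 : c < 1 := (mean_mem_Ioo (μ := ν)).2
  set P : ℝ → ℝ := fun x => ∫ ω, optimalPrice μ x ω ∂ν with hP
  have h1 : (1 : ℝ) ∈ Icc (0 : ℝ) 1 := by simp
  have hcont : ContinuousWithinAt (fun x => (1 - δ) * (x - c) - δ * (P 1 - P x)) (Icc 0 1) 1 := by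
    have hPc : ContinuousWithinAt P (Icc 0 1) 1 := continuousOn_integral_optimalPrice 1 h1
    exact (continuousWithinAt_const.mul (continuousWithinAt_id.sub continuousWithinAt_const)).sub
      (continuousWithinAt_const.mul (continuousWithinAt_const.sub hPc))
  have hpos : 0 < (1 - δ) * (1 - c) - δ * (P 1 - P 1) := by
    rw [sub_self, mul_zero, sub_zero]
    exact mul_pos (sub_pos.2 hδ1) (sub_pos.2 hc1)
  have hev := (hcont.mono Ico_subset_Icc_self).eventually (lt_mem_nhds hpos)
  have : (𝓝[Ico (0 : ℝ) 1] 1).NeBot := by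
    rw [← mem_closure_iff_nhdsWithin_neBot, closure_Ico zero_ne_one]
    exact h1
  obtain ⟨x, hx, hxI⟩ := (hev.and self_mem_nhdsWithin).exists
  refine lt_of_lt_of_le ?_ (dynamicProfit_le_best (μ := μ) (ν := ν) δ ⟨hxI.1, hxI.2.le⟩)
  have h2 := lateRevenue_one_sub_le (μ := μ) (ν := ν) ⟨hxI.1, hxI.2.le⟩
  have h3 := mul_le_mul_of_nonneg_left h2 hδ0
  have h4 := mul_pos (demand_pos (μ := μ) hxI.2) hx
  simp only [dynamicProfit, revenue]
  simp only [hP, hc] at h4 ⊢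
  linarith

theorem isGreatest_achievableD {f g : ℝ → ℝ} [FullLaw (law f)] [FullLaw (law g)] {δ : ℝ}
    (hδ : δ ∈ Ioo (0 : ℝ) 1) :
    IsGreatest (achievableD f g δ) (bestDynamic (law f) (law g) δ) := by
  have hpos : 0 < bestDynamic (law f) (law g) δ :=
    (mul_pos hδ.1 lateRevenue_one_pos).trans (late_lt_bestDynamic hδ.1.le hδ.2)
  constructor
  · obtain ⟨x, hx, he⟩ := (isGreatest_bestDynamic (μ := law f) (ν := law g) δ).1
    rcases hx.1.eq_or_lt with rfl | hx0
    · -- The threshold `0` yields a negative profit, so it is not optimal.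
      exfalso
      have hp : ∀ ω, optimalPrice (law f) 0 ω = 0 := fun ω =>
        le_antisymm (optimalPrice_mem le_rfl ω).1.2 (optimalPrice_mem le_rfl ω).1.1
      have hm := (mean_mem_Ioo (μ := law g)).1
      simp only [dynamicProfit, lateRevenue, hp, revenue, demand_of_nonpos (le_refl (0 : ℝ)),
        zero_sub, one_mul] at he
      rw [integral_neg] at he
      linarith
    · rw [← he]
      exact dynamicProfit_mem_achievableD hδ.1.le hδ.2.le ⟨hx0, hx.2⟩
  · rintro r ⟨p₀, x, p₁, β, h, rfl⟩
    rcases h.threshold_mem.1.eq_or_lt with rfl | hx0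
    · exact (h.profit_nonpos hδ.1.le).trans hpos.le
    · rw [h.profit_eq hδ.1.le hx0]
      exact dynamicProfit_le_best δ h.threshold_mem

/-! ### The three benchmarks -/

theorem isGreatest_achievableEAFP {f g : ℝ → ℝ} [FullLaw (law f)] [FullLaw (law g)] :
    IsGreatest (achievableEAFP f g) (bestDynamic (law f) (law g) 0) := by
  have e : ∀ x, dynamicProfit (law f) (law g) 0 x = profitEAFP f g x := fun x => by
    simp [dynamicProfit, revenue, profitEAFP, demand, meanCost]
  have hle : ∀ x ∈ Icc (0 : ℝ) 1, profitEAFP f g x ≤ bestDynamic (law f) (law g) 0 :=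
    fun x hx => (e x).symm.trans_le (dynamicProfit_le_best 0 hx)
  constructor
  · obtain ⟨x, _, he⟩ := (isGreatest_bestDynamic (μ := law f) (ν := law g) 0).1
    exact ⟨x, by rw [← e, he]⟩
  · rintro r ⟨p, rfl⟩
    rcases lt_or_ge p 0 with hp | hp
    · refine le_trans ?_ (hle 0 (by simp))
      change demand (law f) p * _ ≤ demand (law f) 0 * _
      rw [demand_of_nonpos hp.le, demand_of_nonpos le_rfl]
      linarith
    rcases le_or_gt p 1 with hp1 | hp1
    · exact hle p ⟨hp, hp1⟩
    · refine le_trans (le_of_eq ?_) (hle 1 (by simp))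
      change demand (law f) p * _ = demand (law f) 1 * _
      rw [demand_of_one_le hp1.le, demand_of_one_le le_rfl, zero_mul, zero_mul]

theorem isGreatest_achievableEPO {f g : ℝ → ℝ} [FullLaw (law f)] [FullLaw (law g)] {δ : ℝ}
    (hδ : 0 ≤ δ) :
    IsGreatest (achievableEPO f g δ) (δ * lateRevenue (law f) (law g) 1) := by
  have h1 : (1 : ℝ) ∈ Icc (0 : ℝ) 1 := by simp
  have hπ : Measurable (optimalPrice (law f) 1) := measurable_optimalPrice h1
  have hπ2 : ∀ ω, optimalPrice (law f) 1 ω ∈ Icc (0 : ℝ) 2 := fun ω =>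
    ⟨(optimalPrice_mem_Icc h1 ω).1, (optimalPrice_mem_Icc h1 ω).2.trans one_le_two⟩
  constructor
  · refine ⟨_, _, buyerFeasible_price hπ, integrable_sellerPayoff_price hπ hπ2, ?_⟩
    rw [directProfit, integral_sellerPayoff_price hπ hπ2, lateRevenue]
  · rintro r ⟨q, t, hB, hint, rfl⟩
    refine mul_le_mul_of_nonneg_left ?_ hδ
    rw [directProfit, integral_prod_symm _ hint, lateRevenue]
    refine integral_le_of_le (integrable_revenue_optimalPrice h1)
      (integral_nonneg fun ω => revenue_optimal_nonneg ω) fun ω hω => ?_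
    exact integral_sellerPayoff_le hB hω (revenue_optimal_nonneg ω) fun p hp =>
      revenue_le_optimal ω hp

/-- The ex-ante optimum is a posted price at which either side may refuse to trade. -/
theorem exists_isGreatest_achievableEAO {f g : ℝ → ℝ} [FullLaw (law f)] [FullLaw (law g)] :
    ∃ p ∈ Icc (0 : ℝ) 1,
      IsGreatest (achievableEAO f g) (demand (law f) p * optionValue (law g) p) ∧
      ∀ p' ∈ Icc (0 : ℝ) 1, demand (law f) p' * optionValue (law g) p'
        ≤ demand (law f) p * optionValue (law g) p := by
  have hc : Continuous fun p => demand (law f) p * optionValue (law g) p :=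
    continuous_demand.mul continuous_optionValue
  obtain ⟨p, hp, hmax⟩ := isCompact_Icc.exists_isMaxOn
    (nonempty_Icc.2 (zero_le_one (α := ℝ))) hc.continuousOn
  refine ⟨p, hp, ⟨?_, ?_⟩, hmax⟩
  · -- Offering the price `2`, which no type accepts, is the seller's refusal to trade.
    set π : ℝ → ℝ := fun ω => if ω ≤ p then p else 2 with hπdef
    have hπ : Measurable π := Measurable.ite measurableSet_Iic measurable_const measurable_const
    have hπ2 : ∀ ω, π ω ∈ Icc (0 : ℝ) 2 := by
      intro ω
      simp only [hπdef]
      split_ifs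
      · exact ⟨hp.1, hp.2.trans one_le_two⟩
      · simp
    refine ⟨_, _, buyerFeasible_price hπ, ?_, integrable_sellerPayoff_price hπ hπ2, ?_⟩
    · intro θ hθ ω hω ω' hω'
      have h2 : ¬ (2 : ℝ) ≤ θ := by linarith [hθ.2]
      by_cases h3 : ω ≤ p <;> by_cases h4 : ω' ≤ p <;> by_cases h5 : p ≤ θ <;>
        simp [priceTransfer, priceAllocation, hπdef, h2, h3, h4, h5]
      exact (not_le.1 h3).le
    · rw [directProfit, integral_sellerPayoff_price hπ hπ2, optionValue, ← integral_const_mul]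
      refine integral_congr_ae (Eventually.of_forall fun ω => ?_)
      simp only [revenue, hπdef]
      split_ifs with h
      · rw [max_eq_left (sub_nonneg.2 h)]
      · rw [demand_of_one_le one_le_two, max_eq_right (by linarith), zero_mul, mul_zero]
  · rintro r ⟨q, t, hB, hS, hint, rfl⟩
    exact directProfit_le_of_truthful hB hS hint
      (mul_nonneg (demand_nonneg p) (optionValue_nonneg p)) hmax

/-- The option not to deliver is worth something at every price below `1`. -/
theorem sub_mean_lt_optionValue [FullLaw ν] {p : ℝ} (hp : p ∈ Ico (0 : ℝ) 1) :
    p - ∫ ω, ω ∂ν < optionValue ν p := by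
  have hi : Integrable (fun ω : ℝ => p - ω) ν := integrable_of_continuous (by fun_prop)
  have hid : Integrable (fun ω : ℝ => ω) ν := integrable_of_continuous continuous_id
  have e : optionValue ν p - (p - ∫ ω, ω ∂ν) = ∫ ω, (max (p - ω) 0 - (p - ω)) ∂ν := by
    rw [integral_sub (integrable_option p) hi, optionValue,
      integral_sub (integrable_const _) hid]
    simp
  rw [← sub_pos, e, integral_pos_iff_support_of_nonneg
    (fun ω => sub_nonneg.2 (le_max_left _ _)) ((integrable_option p).sub hi)]
  refine (FullLaw.pos (μ := ν) p 1 hp.1 hp.2 le_rfl).trans_le (measure_mono fun ω hω => ?_)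
  have h := hω.1
  rw [Function.mem_support, max_eq_right (by linarith)]
  linarith

/-- The best ex-ante fixed price does worse than the best posted price with an option to refuse. -/
theorem bestDynamic_zero_lt [FullLaw μ] [FullLaw ν] {M : ℝ}
    (hM : ∀ p ∈ Icc (0 : ℝ) 1, demand μ p * optionValue ν p ≤ M) : bestDynamic μ ν 0 < M := by
  have hm := mean_mem_Ioo (μ := ν)
  have e : ∀ x, dynamicProfit μ ν 0 x = demand μ x * (x - ∫ ω, ω ∂ν) := fun x => by
    simp [dynamicProfit, revenue]
  obtain ⟨x, hx, he⟩ := (isGreatest_bestDynamic (μ := μ) (ν := ν) 0).1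
  rcases hx.2.eq_or_lt with rfl | hx1
  · -- The price `1` earns nothing, whereas any price between the mean cost and `1` earns a profit.
    have h1 := dynamicProfit_le_best (μ := μ) (ν := ν) 0
      (x := (∫ ω, ω ∂ν + 1) / 2) ⟨by linarith [hm.1], by linarith [hm.2]⟩
    rw [← he, e, e, demand_of_one_le le_rfl, zero_mul] at h1
    have h2 := mul_pos (demand_pos (μ := μ) (p := (∫ ω, ω ∂ν + 1) / 2) (by linarith [hm.2]))
      (sub_pos.2 (by linarith [hm.2] : ∫ ω, ω ∂ν < (∫ ω, ω ∂ν + 1) / 2))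
    exact absurd h1 h2.not_ge
  · rw [← he, e]
    exact (mul_lt_mul_of_pos_left (sub_mean_lt_optionValue ⟨hx.1, hx1⟩) (demand_pos hx1)).trans_le
      (hM x hx)

/-- Adapting the price to the cost is worth something: a constant price with an option to refuse
earns nothing at the costs above it. -/
theorem mul_optionValue_lt_lateRevenue [FullLaw μ] [FullLaw ν] {p : ℝ} (hp : p ∈ Icc (0 : ℝ) 1) :
    demand μ p * optionValue ν p < lateRevenue μ ν 1 := by
  rcases hp.2.eq_or_lt with rfl | hp1
  · rw [demand_of_one_le le_rfl, zero_mul]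
    exact lateRevenue_one_pos
  have h1 : (1 : ℝ) ∈ Icc (0 : ℝ) 1 := by simp
  have i1 := integrable_revenue_optimalPrice (μ := μ) (ν := ν) h1
  have i2 := (integrable_option (ν := ν) p).const_mul (demand μ p)
  have i3 : Integrable (fun ω => revenue μ (optimalPrice μ 1 ω) ω
      - demand μ p * max (p - ω) 0) ν := i1.sub i2
  rw [← sub_pos, optionValue, ← integral_const_mul, lateRevenue, ← integral_sub i1 i2,
    integral_pos_iff_support_of_nonneg ?_ i3]
  · refine (FullLaw.pos (μ := ν) p 1 hp.1 hp1 le_rfl).trans_le (measure_mono fun ω hω => ?_)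
    rw [Function.mem_support, max_eq_right (sub_nonpos.2 hω.1.le), mul_zero, sub_zero]
    exact (revenue_optimal_pos ⟨hp.1.trans hω.1.le, hω.2⟩).ne'
  · intro ω
    rw [Pi.zero_apply, sub_nonneg]
    rcases le_total ω p with h | h
    · rw [max_eq_left (sub_nonneg.2 h)]
      exact revenue_le_optimal ω hp
    · rw [max_eq_right (sub_nonpos.2 h), mul_zero]
      exact revenue_optimal_nonneg ω

/-! ### Comparison of the mechanisms -/

/-- A convex function that starts below the level `M` at `0` and exceeds it at `b` crosses it
exactly once on `(0, ∞)`, from below. -/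
theorem exists_crossing_of_convexOn {φ : ℝ → ℝ} {b M : ℝ} (hφ : ConvexOn ℝ univ φ) (hb : 0 < b)
    (h0 : φ 0 < M) (hM : M < φ b) :
    ∃ s ∈ Ioo 0 b, φ s = M ∧ (∀ δ, s < δ → M < φ δ) ∧ ∀ δ, 0 < δ → δ < s → φ δ < M := by
  have hc : ContinuousOn φ (Icc 0 b) := (hφ.continuousOn isOpen_univ).mono (subset_univ _)
  obtain ⟨s, hs, he⟩ := intermediate_value_Ioo hb.le hc ⟨h0, hM⟩
  refine ⟨s, hs, he, fun δ hδ => ?_, fun δ hδ0 hδ => ?_⟩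
  · have hδ0 : 0 < δ := hs.1.trans hδ
    have h := hφ.2 (mem_univ 0) (mem_univ δ)
      (sub_nonneg.2 ((div_le_one hδ0).2 hδ.le)) (div_nonneg hs.1.le hδ0.le) (sub_add_cancel 1 _)
    have e : (1 - s / δ) • (0 : ℝ) + (s / δ) • δ = s := by
      simp [div_mul_cancel₀ _ hδ0.ne']
    rw [e, he, smul_eq_mul, smul_eq_mul] at h
    have h1 : 0 < s / δ := div_pos hs.1 hδ0
    have h2 : 0 < 1 - s / δ := sub_pos.2 ((div_lt_one hδ0).2 hδ)
    by_contra! h3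
    nlinarith [mul_lt_mul_of_pos_left h0 h2, mul_le_mul_of_nonneg_left h3 h1.le]
  · have h := hφ.2 (mem_univ 0) (mem_univ s)
      (sub_nonneg.2 ((div_le_one hs.1).2 hδ.le)) (div_nonneg hδ0.le hs.1.le) (sub_add_cancel 1 _)
    have e : (1 - δ / s) • (0 : ℝ) + (δ / s) • s = δ := by
      simp [div_mul_cancel₀ _ hs.1.ne']
    rw [e, he, smul_eq_mul, smul_eq_mul] at h
    have h2 : 0 < 1 - δ / s := sub_pos.2 ((div_lt_one hs.1).2 hδ)
    nlinarith [mul_lt_mul_of_pos_left h0 h2]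

end DelayedTrade

theorem mainTheorem1 (f g : ℝ → ℝ)
    (hf : DelayedTrade.IsPositiveDensity f) (hreg : DelayedTrade.IsRegular f)
    (hg : DelayedTrade.IsPositiveDensity g) :
    -- the four maximal profits are attained
    (IsGreatest (DelayedTrade.achievableEAFP f g) (DelayedTrade.maxEAFP f g) ∧
      IsGreatest (DelayedTrade.achievableEAO f g) (DelayedTrade.maxEAO f g) ∧
      ∀ δ ∈ Set.Ioo (0 : ℝ) 1,
        IsGreatest (DelayedTrade.achievableEPO f g δ) (DelayedTrade.maxEPO f g δ) ∧
        IsGreatest (DelayedTrade.achievableD f g δ) (DelayedTrade.maxD f g δ)) ∧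
    -- `δbar` is the threshold between EAO and EPO
    ∃ δbar ∈ Set.Ioo (0 : ℝ) 1,
      (∀ δ ∈ Set.Ioo (0 : ℝ) 1,
        (δbar < δ → DelayedTrade.maxEAO f g < DelayedTrade.maxEPO f g δ) ∧
        (δ < δbar → DelayedTrade.maxEPO f g δ < DelayedTrade.maxEAO f g)) ∧
      -- `δs` is the threshold between EAO and D
      ∃ δs ∈ Set.Ioo (0 : ℝ) 1, δs < δbar ∧
        DelayedTrade.maxD f g δs = DelayedTrade.maxEAO f g ∧
        (∀ δ ∈ Set.Ioo (0 : ℝ) 1, δs < δ →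
          DelayedTrade.maxEAFP f g < DelayedTrade.maxD f g δ ∧
          DelayedTrade.maxEPO f g δ < DelayedTrade.maxD f g δ ∧
          DelayedTrade.maxEAO f g < DelayedTrade.maxD f g δ) ∧
        (∀ δ ∈ Set.Ioo (0 : ℝ) 1, δ < δs →
          DelayedTrade.maxEAFP f g < DelayedTrade.maxEAO f g ∧
          DelayedTrade.maxEPO f g δ < DelayedTrade.maxEAO f g ∧
          DelayedTrade.maxD f g δ < DelayedTrade.maxEAO f g) := by
  have := hf.fullLaw
  have := hg.fullLaw
  obtain ⟨p, hp, hEAO, hmax⟩ := DelayedTrade.exists_isGreatest_achievableEAO (f := f) (g := g)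
  set M := DelayedTrade.demand (DelayedTrade.law f) p *
    DelayedTrade.optionValue (DelayedTrade.law g) p
  set L := DelayedTrade.lateRevenue (DelayedTrade.law f) (DelayedTrade.law g) 1
  set φ := DelayedTrade.bestDynamic (DelayedTrade.law f) (DelayedTrade.law g)
  have hEAFP := DelayedTrade.isGreatest_achievableEAFP (f := f) (g := g)
  have e1 : DelayedTrade.maxEAFP f g = φ 0 := hEAFP.csSup_eq
  have e2 : DelayedTrade.maxEAO f g = M := hEAO.csSup_eq
  have hEPO : ∀ δ ∈ Ioo (0 : ℝ) 1, IsGreatest (DelayedTrade.achievableEPO f g δ) (δ * L) :=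
    fun δ hδ => DelayedTrade.isGreatest_achievableEPO hδ.1.le
  have hD : ∀ δ ∈ Ioo (0 : ℝ) 1, IsGreatest (DelayedTrade.achievableD f g δ) (φ δ) :=
    fun δ hδ => DelayedTrade.isGreatest_achievableD hδ
  have e3 : ∀ δ ∈ Ioo (0 : ℝ) 1, DelayedTrade.maxEPO f g δ = δ * L :=
    fun δ hδ => (hEPO δ hδ).csSup_eq
  have e4 : ∀ δ ∈ Ioo (0 : ℝ) 1, DelayedTrade.maxD f g δ = φ δ :=
    fun δ hδ => (hD δ hδ).csSup_eq
  have h0M : φ 0 < M := DelayedTrade.bestDynamic_zero_lt hmax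
  have hML : M < L := DelayedTrade.mul_optionValue_lt_lateRevenue hp
  have hLD : ∀ δ ∈ Ioo (0 : ℝ) 1, δ * L < φ δ :=
    fun δ hδ => DelayedTrade.late_lt_bestDynamic hδ.1.le hδ.2
  have h0 : 0 ≤ φ 0 := by
    have := hEAFP.2 ⟨1, rfl⟩
    have h1 : (DelayedTrade.law f).real (Ici 1) = 0 := DelayedTrade.demand_of_one_le le_rfl
    rwa [DelayedTrade.profitEAFP, h1, zero_mul] at this
  have hM0 : 0 < M := h0.trans_lt h0M
  have hL0 : 0 < L := hM0.trans hML
  have hbar : M / L ∈ Ioo (0 : ℝ) 1 := ⟨div_pos hM0 hL0, (div_lt_one hL0).2 hML⟩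
  obtain ⟨s, hs, hsM, hgt, hlt⟩ := DelayedTrade.exists_crossing_of_convexOn
    (DelayedTrade.convexOn_bestDynamic (μ := DelayedTrade.law f) (ν := DelayedTrade.law g))
    hbar.1 h0M (by
      have := hLD _ hbar
      rwa [div_mul_cancel₀ _ hL0.ne'] at this)
  have hs1 : s ∈ Ioo (0 : ℝ) 1 := ⟨hs.1, hs.2.trans hbar.2⟩
  refine ⟨⟨e1 ▸ hEAFP, e2 ▸ hEAO, fun δ hδ => ⟨e3 δ hδ ▸ hEPO δ hδ, e4 δ hδ ▸ hD δ hδ⟩⟩,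
    M / L, hbar, fun δ hδ => ?_, s, hs1, hs.2, ?_, fun δ hδ hsδ => ?_, fun δ hδ hδs => ?_⟩
  · rw [e2, e3 δ hδ]
    exact ⟨fun h => (div_lt_iff₀ hL0).1 h, fun h => (lt_div_iff₀ hL0).1 h⟩
  · rw [e4 s hs1, e2]
    exact hsM
  · rw [e1, e2, e3 δ hδ, e4 δ hδ]
    exact ⟨h0M.trans (hgt δ hsδ), hLD δ hδ, hgt δ hsδ⟩
  · rw [e1, e2, e3 δ hδ, e4 δ hδ]
    exact ⟨h0M, (lt_div_iff₀ hL0).1 (hδs.trans hs.2), hlt δ hδ.1 hδs⟩
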